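/- **Setting.** Let $T>0$, $\overline\Omega=[0,T]\times\mathbb R$, let $W,Y$ be metric spaces, let $Z(t,x)\subset Y$ for $(t,x)\in\overline\Omega$, and let $a,b,f$ (functions of $(t,x,w)\in\overline\Omega\times W$), $g$ (a function of $x\in\mathbb R$) and $\Gamma,K$ (functions of $(t,x,z)$ with $(t,x)\in\overline\Omega$, $z\in Z(t,x)$) be real-valued. Put $\mathcal M V(t,x)=\sup_{z\in Z(t,x)}\{V(t,\Gamma(t,x,z))+K(t,x,z)\}$ and $$F((t,x),r,(q,p),A,\ell)=\begin{cases}\min\{-q-\sup_{w\in W}\{\tfrac12 b(t,x,w)^2A+a(t,x,w)p+f(t,x,w)\},\,r-\ell\}&t<T,\\ \min\{r-g(x),\,r-\ell\}&t=T.\end{cases}$$ Let $F_*,F^*$ be the lower and upper semicontinuous envelopes of $F$ on $\overline\Omega\times\mathbb R\times\mathbb R^2\times\mathbb R\times\mathbb R$. An upper (resp. lower) semicontinuous $V:\overline\Omega\to\mathbb R$ is a *viscosity subsolution* (resp. *supersolution*) of the HJBQVI if for every $C^2$ function $\varphi$ and every $(t,x)\in\overline\Omega$ at which $V-\varphi$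 has a local maximum (resp. minimum) relative to $\overline\Omega$, $$F_*((t,x),V,(\varphi_t,\varphi_x),\varphi_{xx},\mathcal MV)\le 0\quad(\text{resp. }F^*((t,x),V,(\varphi_t,\varphi_x),\varphi_{xx},\mathcal MV)\ge0)\quad\text{at }(t,x);$$ a *solution* is both. The HJBQVI satisfies a *comparison principle* if $U\le V$ on $\overline\Omega$ for every bounded subsolution $U$ and bounded supersolution $V$. **Schemes.** The mesh parameter $h$ ranges over a set $H\subset(0,\infty)$ with $0\in\overline H$. For $h\in H$ let $\Delta\tau=T/N=c_\tau h$ and $\Delta x=c_xh$ with constants $c_\tau,c_x>0$ and $N=N(h)\in\mathbb N$; let $M=M(h)\in\mathbb N$ with $M\Delta x\to\infty$ as $h\to0$; let $\tau^n=T-n\Delta\tau$ $(0\le n\le N)$ and $x_i=(i-M/2)\Delta x$ $(0\le i\le M)$. Let $W^h\subset W$ and $Z^h(t,x)\subset Z(t,x)$ be finite and nonempty. For $U=(U_0,\dots,U_M)$ let $(\mathcal D_2U)_i=(U_{i+1}-2U_i+U_{i-1})/(\Delta x)^2$, $(\mathcal D_+U)_i=(U_{i+1}-U_i)/\Delta x$,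 $(\mathcal D_-U)_i=(U_i-U_{i-1})/\Delta x$ for $0<i<M$, and all three $0$ for $i\in\{0,M\}$; let $\alpha(\mathcal DU)_i$ be $\alpha(\mathcal D_+U)_i$ if $\alpha>0$ and $\alpha(\mathcal D_-U)_i$ otherwise. Let $\operatorname{interp}(U,\cdot)$ be the piecewise linear interpolant of $U$ on the grid, equal to $U_0$ on $(-\infty,x_0]$ and to $U_M$ on $[x_M,\infty)$, and let $$(\mathcal M_nU)_i=\sup_{z\in Z^h(\tau^n,x_i)}\{\operatorname{interp}(U,\Gamma(\tau^n,x_i,z))+K(\tau^n,x_i,z)\}.$$ Write $a_i^n(w)=a(\tau^n,x_i,w)$, and similarly for $b,f$, and $\gamma_i^n(V,w)=\frac{V_i^{n-1}-V_i^n}{\Delta\tau}+\tfrac12b_i^n(w)^2(\mathcal D_2V^n)_i+a_i^n(w)(\mathcal DV^n)_i+f_i^n(w)$. In each scheme the unknown is $(V_i^n)_{0\le n\le N,\,0\le i\le M}$ with $V_i^0=g(x_i)$ for all $i$, and for all $1\le n\le N$, $0\le i\le M$ (suprema over $d\in\{0,1\}$ and $w\in W^h$): * *direct control*: $\sup_{d,w}\{(1-d)\gamma_i^n(V,w)+d((\mathcal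 M_nV^n)_i-V_i^n)\}=0$; * *penalty*, with $\epsilon=\epsilon(h)>0$: $\sup_{d,w}\{(1-d)\gamma_i^n(V,w)+d((\mathcal M_nV^n)_i-V_i^n+\epsilon\gamma_i^n(V,w))\}=0$; * *explicit-impulse*, when $b=b(t,x)$ does not depend on $w$: $$\sup_{d,w}\Big\{(1-d)\Big(\tfrac{\operatorname{interp}(V^{n-1},x_i+a_i^n(w)\Delta\tau)-V_i^n}{\Delta\tau}+\tfrac12(b_i^n)^2(\mathcal D_2V^n)_i+f_i^n(w)\Big)+d\Big((\mathcal M_nV^{n-1})_i-V_i^n+\tfrac12(b_i^n)^2(\mathcal D_2V^n)_i\Delta\tau\Big)\Big\}=0.$$ A solution $(V_i^n)$ is extended to a piecewise constant function $V^h:\overline\Omega\to\mathbb R$ by replacing each of $t$ and $x$ by its nearest grid value (the larger one in case of a tie). **Assumptions.** * (H1) $f,g,a,b,\Gamma,K$ are continuous, $f$ and $g$ are bounded, and $\sup_{z\in Z(T,x)}\{g(\Gamma(T,x,z))+K(T,x,z)\}\le g(x)$ for all $x$. * (H2) $W$ is nonempty and compact, and each $Z(t,x)$ is a nonempty compact subset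 of $Y$. * (H3) $\sup_{(t,x)\in\overline\Omega,\ z\in Z(t,x)}K(t,x,z)<0$. * (H4) As $h\to0$, $W^h\to W$ in the Hausdorff metric and $Z^h\to Z$ locally uniformly on $\overline\Omega$ in the Hausdorff metric; for each $h$, $(t,x)\mapsto Z^h(t,x)$ is continuous in the Hausdorff metric. **Theorem.** Assume (H1)–(H4) and that the HJBQVI satisfies a comparison principle. Then the HJBQVI has a unique bounded viscosity solution $V$ on $\overline\Omega$, and, as $h\to0$ in $H$, each of the following families converges to $V$ locally uniformly on $\overline\Omega$: 1. every family $(V^h)_{h\in H}$ of solutions of the direct control scheme; 2. every family $(V^h)_{h\in H}$ of solutions of the penalty scheme, whenever $\epsilon(h)>0$ and $\epsilon(h)\to0$ as $h\to0$; 3. if $b$ does not depend on $w$, every family $(V^h)_{h\in H}$ of solutions of the explicit-impulse scheme. -/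

import Mathlib

open Filter Topology Set

noncomputable section

namespace HJBQVI

/-- `sup_{a ∈ s} f a`; used below only for nonempty `s` on which `f` is bounded. -/
def supOn {α : Type*} (s : Set α) (f : α → ℝ) : ℝ := sSup (f '' s)

/-- The data of the one-dimensional impulse control problem on `[0, T] × ℝ`.
The functions `a, b, f, Γ, K` and the control sets `Z` matter only at points `(t, x)` with
`0 ≤ t ≤ T`, and `Γ, K` only for impulses `z ∈ Z (t, x)`. -/
structure Problem (W Y : Type*) [MetricSpace Y] where
  T : ℝ
  T_pos : 0 < T
  a : ℝ × ℝ → W → ℝ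
  b : ℝ × ℝ → W → ℝ
  f : ℝ × ℝ → W → ℝ
  g : ℝ → ℝ
  Γ : ℝ × ℝ → Y → ℝ
  K : ℝ × ℝ → Y → ℝ
  Z : ℝ × ℝ → TopologicalSpace.NonemptyCompacts Y

namespace Problem

variable {W Y : Type*} [MetricSpace Y] (P : Problem W Y)

/-- The closed domain `[0, T] × ℝ`. -/
def dom : Set (ℝ × ℝ) := Icc 0 P.T ×ˢ univ

/-- The set of all `((t, x), z)` with `(t, x)` in the domain and `z ∈ Z (t, x)`. -/
def impulseGraph : Set ((ℝ × ℝ) × Y) := {q | q.1 ∈ P.dom ∧ q.2 ∈ (P.Z q.1 : Set Y)}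

/-- The intervention operator
`(𝓜 V)(t, x) = sup_{z ∈ Z (t, x)} (V (t, Γ (t, x, z)) + K (t, x, z))`. -/
def intervention (V : ℝ × ℝ → ℝ) (p : ℝ × ℝ) : ℝ :=
  supOn (P.Z p : Set Y) fun z => V (p.1, P.Γ p z) + P.K p z

/-- The function `F ((t, x), r, (q, p), A, ℓ)` of the HJBQVI. -/
def F : (ℝ × ℝ) × ℝ × (ℝ × ℝ) × ℝ × ℝ → ℝ
  | (y, r, (q, p), A, ℓ) =>
    if y.1 < P.T then
      min (-q - supOn univ fun w => 1 / 2 * P.b y w ^ 2 * A + P.a y w * p + P.f y w) (r - ℓ)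
    else
      min (r - P.g y.2) (r - ℓ)

/-- Where `F` is defined: `(t, x)` is in the domain, the other arguments are arbitrary. -/
def domF : Set ((ℝ × ℝ) × ℝ × (ℝ × ℝ) × ℝ × ℝ) := P.dom ×ˢ univ

/-- The lower semicontinuous envelope `F_*` (in all the arguments jointly). -/
def Flower (q : (ℝ × ℝ) × ℝ × (ℝ × ℝ) × ℝ × ℝ) : ℝ := liminf P.F (𝓝[P.domF] q)

/-- The upper semicontinuous envelope `F^*` (in all the arguments jointly). -/
def Fupper (q : (ℝ × ℝ) × ℝ × (ℝ × ℝ) × ℝ × ℝ) : ℝ := limsup P.F (𝓝[P.domF] q)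

/-- The arguments `((t, x), V, (φ_t, φ_x), φ_xx, 𝓜 V)` at the point `y = (t, x)`. -/
def jet (V φ : ℝ × ℝ → ℝ) (y : ℝ × ℝ) : (ℝ × ℝ) × ℝ × (ℝ × ℝ) × ℝ × ℝ :=
  (y, V y, (deriv (fun s => φ (s, y.2)) y.1, deriv (fun x => φ (y.1, x)) y.2),
    iteratedDeriv 2 (fun x => φ (y.1, x)) y.2, P.intervention V y)

/-- Viscosity subsolution on `[0, T] × ℝ`; extrema are relative to the closed domain. Only the
germ of `φ` at `y` matters, so test functions may be taken to be `C²` on the whole plane. -/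
def IsSubsolution (V : ℝ × ℝ → ℝ) : Prop :=
  UpperSemicontinuousOn V P.dom ∧
    ∀ φ : ℝ × ℝ → ℝ, ContDiff ℝ 2 φ → ∀ y ∈ P.dom,
      IsLocalMaxOn (fun z => V z - φ z) P.dom y → P.Flower (P.jet V φ y) ≤ 0

/-- Viscosity supersolution on `[0, T] × ℝ`. -/
def IsSupersolution (V : ℝ × ℝ → ℝ) : Prop :=
  LowerSemicontinuousOn V P.dom ∧
    ∀ φ : ℝ × ℝ → ℝ, ContDiff ℝ 2 φ → ∀ y ∈ P.dom,
      IsLocalMinOn (fun z => V z - φ z) P.dom y → 0 ≤ P.Fupper (P.jet V φ y)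

/-- Viscosity solution of the HJBQVI. -/
def IsSolution (V : ℝ × ℝ → ℝ) : Prop := P.IsSubsolution V ∧ P.IsSupersolution V

/-- `V` is bounded on `[0, T] × ℝ`. -/
def IsBdd (V : ℝ × ℝ → ℝ) : Prop := ∃ C : ℝ, ∀ y ∈ P.dom, |V y| ≤ C

/-- The comparison principle for the HJBQVI. -/
def Comparison : Prop :=
  ∀ U V : ℝ × ℝ → ℝ, P.IsBdd U → P.IsBdd V → P.IsSubsolution U → P.IsSupersolution V →
    ∀ y ∈ P.dom, U y ≤ V y

/-- (H1): continuity of the data, boundedness of `f` and `g`, and `𝓜 g ≤ g`. -/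
structure H1 [TopologicalSpace W] : Prop where
  continuous_a : ContinuousOn (fun q : (ℝ × ℝ) × W => P.a q.1 q.2) (P.dom ×ˢ univ)
  continuous_b : ContinuousOn (fun q : (ℝ × ℝ) × W => P.b q.1 q.2) (P.dom ×ˢ univ)
  continuous_f : ContinuousOn (fun q : (ℝ × ℝ) × W => P.f q.1 q.2) (P.dom ×ˢ univ)
  continuous_g : Continuous P.g
  continuous_Γ : ContinuousOn (fun q : (ℝ × ℝ) × Y => P.Γ q.1 q.2) P.impulseGraph
  continuous_K : ContinuousOn (fun q : (ℝ × ℝ) × Y => P.K q.1 q.2) P.impulseGraph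
  bounded_f : ∃ C : ℝ, ∀ y ∈ P.dom, ∀ w, |P.f y w| ≤ C
  bounded_g : ∃ C : ℝ, ∀ x, |P.g x| ≤ C
  suboptimal : ∀ x : ℝ, P.intervention (fun y => P.g y.2) (P.T, x) ≤ P.g x

/-- (H3): `sup K < 0`, the supremum being over all `(t, x)` and all `z ∈ Z (t, x)`. -/
def H3 : Prop := ∃ c : ℝ, c < 0 ∧ ∀ q ∈ P.impulseGraph, P.K q.1 q.2 ≤ c

end Problem

/-- A family of discretisations of the problem `P`, indexed by the mesh parameters `h ∈ H`:
time steps `Δτ = T / N = cτ h`, space steps `Δx = cx h`, grid points `x_i = (i - M/2) Δx`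
(`0 ≤ i ≤ M`) with `M Δx → ∞`, and finite nonempty subsets `W^h ⊆ W`, `Z^h (t, x) ⊆ Z (t, x)`. -/
structure Discretization {W Y : Type*} [MetricSpace Y] (P : Problem W Y) where
  H : Set ℝ
  H_pos : ∀ h ∈ H, 0 < h
  H_zero : (0 : ℝ) ∈ closure H
  cτ : ℝ
  cτ_pos : 0 < cτ
  cx : ℝ
  cx_pos : 0 < cx
  N : ℝ → ℕ
  step_eq : ∀ h ∈ H, P.T / N h = cτ * h
  M : ℝ → ℕ
  width : Tendsto (fun h => (M h : ℝ) * (cx * h)) (𝓝[H] 0) atTop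
  Wh : ℝ → Finset W
  Wh_nonempty : ∀ h ∈ H, (Wh h).Nonempty
  Zh : ℝ → ℝ × ℝ → TopologicalSpace.NonemptyCompacts Y
  Zh_finite : ∀ h ∈ H, ∀ y ∈ P.dom, (Zh h y : Set Y).Finite
  Zh_subset : ∀ h ∈ H, ∀ y ∈ P.dom, (Zh h y : Set Y) ⊆ (P.Z y : Set Y)

namespace Discretization

variable {W Y : Type*} [MetricSpace Y] {P : Problem W Y} (D : Discretization P)

/-- (H4): `W^h → W` in the Hausdorff metric; `Z^h → Z` locally uniformly on `[0, T] × ℝ` and each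
`Z^h` is continuous, both in the Hausdorff metric, which is the metric of `NonemptyCompacts Y`. -/
structure H4 [MetricSpace W] : Prop where
  tendsto_W : Tendsto (fun h => Metric.hausdorffDist (D.Wh h : Set W) univ) (𝓝[D.H] 0) (𝓝 0)
  tendsto_Z : TendstoLocallyUniformlyOn D.Zh P.Z (𝓝[D.H] 0) P.dom
  continuous_Zh : ∀ h ∈ D.H, ContinuousOn (D.Zh h) P.dom

/-- `Δτ = T / N`. -/
def dt (h : ℝ) : ℝ := P.T / D.N h

/-- `Δx`. -/
def dx (h : ℝ) : ℝ := D.cx * h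

/-- `τ^n = T - n Δτ`. -/
def time (h : ℝ) (n : ℕ) : ℝ := P.T - n * D.dt h

/-- `x_i = (i - M/2) Δx`. -/
def node (h : ℝ) (i : ℕ) : ℝ := (i - (D.M h : ℝ) / 2) * D.dx h

/-- `(τ^n, x_i)`. -/
def pt (h : ℝ) (n i : ℕ) : ℝ × ℝ := (D.time h n, D.node h i)

/-- Second difference, zero at the two ends of the grid. -/
def D2 (h : ℝ) (U : ℕ → ℝ) (i : ℕ) : ℝ :=
  if 0 < i ∧ i < D.M h then (U (i + 1) - 2 * U i + U (i - 1)) / D.dx h ^ 2 else 0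

/-- Forward difference, zero at the two ends of the grid. -/
def Dplus (h : ℝ) (U : ℕ → ℝ) (i : ℕ) : ℝ :=
  if 0 < i ∧ i < D.M h then (U (i + 1) - U i) / D.dx h else 0

/-- Backward difference, zero at the two ends of the grid. -/
def Dminus (h : ℝ) (U : ℕ → ℝ) (i : ℕ) : ℝ :=
  if 0 < i ∧ i < D.M h then (U i - U (i - 1)) / D.dx h else 0

/-- The upwind discretisation of `α V_x` for a coefficient `α`. -/
def upwind (h : ℝ) (α : ℝ) (U : ℕ → ℝ) (i : ℕ) : ℝ :=
  if 0 < α then α * D.Dplus h U i else α * D.Dminus h U i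

/-- Linear interpolation of the grid vector `(U_0, …, U_M)`, constant outside of the grid. -/
def interp (h : ℝ) (U : ℕ → ℝ) (x : ℝ) : ℝ :=
  if x ≤ D.node h 0 then U 0
  else if D.node h (D.M h) ≤ x then U (D.M h)
  else
    let k := ⌊(x - D.node h 0) / D.dx h⌋₊
    let α := (x - D.node h k) / D.dx h
    α * U (k + 1) + (1 - α) * U k

/-- The discretised intervention operator `(𝓜_n U)_i`. -/
def discreteIntervention (h : ℝ) (n : ℕ) (U : ℕ → ℝ) (i : ℕ) : ℝ :=
  supOn (D.Zh h (D.pt h n i) : Set Y) fun z =>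
    D.interp h U (P.Γ (D.pt h n i) z) + P.K (D.pt h n i) z

/-- `γ_i^n (V, w)`; a grid function is written `v n i = V (τ^n, x_i)`. -/
def gam (h : ℝ) (v : ℕ → ℕ → ℝ) (n i : ℕ) (w : W) : ℝ :=
  (v (n - 1) i - v n i) / D.dt h + 1 / 2 * P.b (D.pt h n i) w ^ 2 * D.D2 h (v n) i
    + D.upwind h (P.a (D.pt h n i) w) (v n) i + P.f (D.pt h n i) w

/-- The set `{0, 1} × W^h` of controls `(d, w)`. -/
def controls (h : ℝ) : Set (ℝ × W) := ({0, 1} : Set ℝ) ×ˢ (D.Wh h : Set W)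

/-- `S (h, (τ^n, x_i), V, ℓ)` for the direct control scheme. -/
def directS (h : ℝ) (n i : ℕ) (v : ℕ → ℕ → ℝ) (ℓ : ℝ) : ℝ :=
  if n = 0 then v n i - P.g (D.node h i)
  else -supOn (D.controls h) fun c =>
    (1 - c.1) * D.gam h v n i c.2 + c.1 * (ℓ - v n i)

/-- `S (h, (τ^n, x_i), V, ℓ)` for the penalty scheme with penalty parameter `ε`. -/
def penaltyS (ε h : ℝ) (n i : ℕ) (v : ℕ → ℕ → ℝ) (ℓ : ℝ) : ℝ :=
  if n = 0 then v n i - P.g (D.node h i)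
  else -supOn (D.controls h) fun c =>
    (1 - c.1) * D.gam h v n i c.2 + c.1 * (ℓ - v n i + ε * D.gam h v n i c.2)

/-- `S (h, (τ^n, x_i), V, ℓ)` for the explicit-impulse scheme, with control-free diffusion
coefficient `b₀ (t, x)`. -/
def explicitS (b₀ : ℝ × ℝ → ℝ) (h : ℝ) (n i : ℕ) (v : ℕ → ℕ → ℝ) (ℓ : ℝ) : ℝ :=
  if n = 0 then v n i - P.g (D.node h i)
  else -supOn (D.controls h) fun c =>
    (1 - c.1) * ((D.interp h (v (n - 1)) (D.node h i + P.a (D.pt h n i) c.2 * D.dt h) - v n i)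
          / D.dt h
        + 1 / 2 * b₀ (D.pt h n i) ^ 2 * D.D2 h (v n) i + P.f (D.pt h n i) c.2)
      + c.1 * (ℓ - v n i + 1 / 2 * b₀ (D.pt h n i) ^ 2 * D.D2 h (v n) i * D.dt h)

/-- `v` solves the direct control scheme at all grid points `0 ≤ n ≤ N`, `0 ≤ i ≤ M`. -/
def SolvesDirect (h : ℝ) (v : ℕ → ℕ → ℝ) : Prop :=
  ∀ n ≤ D.N h, ∀ i ≤ D.M h,
    D.directS h n i v (D.discreteIntervention h n (v n) i) = 0

/-- `v` solves the penalty scheme. -/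
def SolvesPenalty (ε h : ℝ) (v : ℕ → ℕ → ℝ) : Prop :=
  ∀ n ≤ D.N h, ∀ i ≤ D.M h,
    D.penaltyS ε h n i v (D.discreteIntervention h n (v n) i) = 0

/-- `v` solves the explicit-impulse scheme; the intervention acts on the previous time step. -/
def SolvesExplicit (b₀ : ℝ × ℝ → ℝ) (h : ℝ) (v : ℕ → ℕ → ℝ) : Prop :=
  ∀ n ≤ D.N h, ∀ i ≤ D.M h,
    D.explicitS b₀ h n i v (D.discreteIntervention h n (v (n - 1)) i) = 0

/-- The piecewise constant extension of a grid function to `[0, T] × ℝ`: each coordinate of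
`(t, x)` is replaced by the nearest grid value (the larger one in case of a tie; `x_0` or `x_M`
for points to the left or the right of the spatial grid). -/
def extend (h : ℝ) (v : ℕ → ℕ → ℝ) (y : ℝ × ℝ) : ℝ :=
  v (min (D.N h) ⌈(P.T - y.1) / D.dt h - 1 / 2⌉₊)
    (min (D.M h) ⌊(y.2 - D.node h 0) / D.dx h + 1 / 2⌋₊)

/-- The solutions `v h` of a scheme converge to `V` locally uniformly on `[0, T] × ℝ` as `h → 0`
in `H`. -/
def ConvergesTo (v : ℝ → ℕ → ℕ → ℝ) (V : ℝ × ℝ → ℝ) : Prop :=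
  TendstoLocallyUniformlyOn (fun h => D.extend h (v h)) V (𝓝[D.H] 0) P.dom

end Discretization

end HJBQVI

end

/-!
Convergence is proved by the method of half-relaxed limits of Barles and Souganidis. For a family of
grid functions `v h` that is bounded uniformly in the mesh, let `D.upper v` and `D.lower v` be the
upper and lower half-relaxed limits of the extensions as `h → 0`. They are semicontinuous, and
`D.lower v ≤ D.upper v`. Once `D.upper v` is a subsolution and `D.lower v` a supersolution,
comparison gives the reverse inequality, so both are the unique bounded solution, and equality
of the two limits is locally uniform convergence (`tendstoLocallyUniformlyOn_of_relaxedLimits`).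

At a local maximum `y` of `D.upper v - φ`, made strict by adding a quartic to `φ`, there are grid
points converging to `y`, with values converging to `D.upper v y`, at which `v - φ` is maximal among
the nearby grid points (`exists_touchesAbove`). There the monotonicity of the schemes bounds the
difference operators of `v` by those of `φ`, which converge to the derivatives of `φ`. The
intervention operator sees `v` itself rather than `φ`: since `Z^h → Z`, the limits of the discrete
interventions are at most `𝓜 (D.upper v)` and, in the mirror image, at least `𝓜 (D.lower v)`
(`le_intervention_of_tendsto`, `intervention_le_of_tendsto`). This suffices because `F` is decreasing
in `ℓ`. All limits are taken along ultrafilters: controls, impulses, interpolation weights and slopes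
range over compact sets and so converge without passing to subsequences, and a disjunction that holds
eventually has a side that holds eventually.

At `t = T` both branches of `F` enter the envelopes (`Flower_nonpos`, `Fupper_nonneg`), according to
whether the grid points have `n ≥ 1` or `n = 0`; in the second case the obstacle inequality for the
lower limit is the hypothesis `𝓜 g ≤ g`.

`IsConsistent` collects what the argument needs of a family, and `isConsistent_penalty` and
`isConsistent_explicit` verify it, the direct control scheme being the penalty scheme with `ε = 0`.
Uniform bounds follow from the maximum principle, an impulse never being optimal at a spatial maximum
because `sup K < 0`. Existence of the solution `V` comes from the direct control scheme, whose
discrete equations are solved by Perron's method (`exists_eq_zero_of_monotone`).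
-/

namespace HJBQVI

/-! ### Half-relaxed limits -/

theorem exists_tendsto_of_isCompact {κ X : Type*} [TopologicalSpace X] {K : Set X}
    (hK : IsCompact K) (G : Ultrafilter κ) {f : κ → X} (hf : ∀ᶠ k in (G : Filter κ), f k ∈ K) :
    ∃ x ∈ K, Tendsto f G (𝓝 x) := by
  have h1 : ((G.map f : Ultrafilter X) : Filter X) ≤ 𝓟 K := by
    rw [Ultrafilter.coe_map, le_principal_iff]
    exact hf
  exact hK.ultrafilter_le_nhds (G.map f) h1

section RelaxedLimits

variable {ι X : Type*} [TopologicalSpace X]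

/-- The upper half-relaxed limit `limsup u i z` as `i` runs along `l` and `z → y` within `S`. -/
noncomputable def upperLimit (l : Filter ι) (S : Set X) (u : ι → X → ℝ) (y : X) : ℝ :=
  limsup (fun q : ι × X => u q.1 q.2) (l ×ˢ 𝓝[S] y)

/-- The lower half-relaxed limit `liminf u i z` as `i` runs along `l` and `z → y` within `S`. It is
defined through the upper one, so that each fact about the upper limit has a mirror image. -/
noncomputable def lowerLimit (l : Filter ι) (S : Set X) (u : ι → X → ℝ) (y : X) : ℝ :=
  -upperLimit l S (fun i z => -u i z) y

variable {l : Filter ι} {S : Set X} {u : ι → X → ℝ} {C : ℝ} {y : X}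

theorem eventually_prod_bound (hb : ∀ᶠ i in l, ∀ z ∈ S, |u i z| ≤ C) (y : X) :
    ∀ᶠ q : ι × X in l ×ˢ 𝓝[S] y, |u q.1 q.2| ≤ C := by
  have h1 : ∀ᶠ z in 𝓝[S] y, z ∈ S := self_mem_nhdsWithin
  filter_upwards [hb.prod_inl (𝓝[S] y), h1.prod_inr l] with q hq hq'
  exact hq _ hq'

theorem isBoundedUnder_prod (hb : ∀ᶠ i in l, ∀ z ∈ S, |u i z| ≤ C) (y : X) :
    IsBoundedUnder (· ≤ ·) (l ×ˢ 𝓝[S] y) (fun q : ι × X => u q.1 q.2) :=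
  ⟨C, (eventually_prod_bound hb y).mono fun _ hq => (abs_le.1 hq).2⟩

theorem isCoboundedUnder_prod [l.NeBot] (hb : ∀ᶠ i in l, ∀ z ∈ S, |u i z| ≤ C) (hy : y ∈ S) :
    IsCoboundedUnder (· ≤ ·) (l ×ˢ 𝓝[S] y) (fun q : ι × X => u q.1 q.2) := by
  have := mem_closure_iff_nhdsWithin_neBot.1 (subset_closure hy)
  have h : IsBoundedUnder (· ≥ ·) (l ×ˢ 𝓝[S] y) (fun q : ι × X => u q.1 q.2) :=
    ⟨-C, (eventually_prod_bound hb y).mono fun _ hq => (abs_le.1 hq).1⟩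
  exact h.isCoboundedUnder_le

theorem eventually_lt_of_upperLimit_lt (hb : ∀ᶠ i in l, ∀ z ∈ S, |u i z| ≤ C) {c : ℝ}
    (hc : upperLimit l S u y < c) : ∀ᶠ q : ι × X in l ×ˢ 𝓝[S] y, u q.1 q.2 < c :=
  eventually_lt_of_limsup_lt hc (isBoundedUnder_prod hb y)

theorem upperLimit_le [l.NeBot] (hb : ∀ᶠ i in l, ∀ z ∈ S, |u i z| ≤ C) (hy : y ∈ S) {c : ℝ}
    (hc : ∀ᶠ q : ι × X in l ×ˢ 𝓝[S] y, u q.1 q.2 ≤ c) : upperLimit l S u y ≤ c :=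
  limsup_le_of_le (isCoboundedUnder_prod hb hy) hc

omit [TopologicalSpace X] in
theorem neg_bound (hb : ∀ᶠ i in l, ∀ z ∈ S, |u i z| ≤ C) :
    ∀ᶠ i in l, ∀ z ∈ S, |(fun i z => -u i z) i z| ≤ C := by
  simpa only [abs_neg] using hb

theorem abs_upperLimit_le [l.NeBot] (hb : ∀ᶠ i in l, ∀ z ∈ S, |u i z| ≤ C) (hy : y ∈ S) :
    |upperLimit l S u y| ≤ C := by
  have := mem_closure_iff_nhdsWithin_neBot.1 (subset_closure hy)
  have h := eventually_prod_bound hb y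
  refine abs_le.2 ⟨?_, upperLimit_le hb hy (h.mono fun _ hq => (abs_le.1 hq).2)⟩
  exact le_limsup_of_frequently_le (h.mono fun _ hq => (abs_le.1 hq).1).frequently
    (isBoundedUnder_prod hb y)

theorem abs_lowerLimit_le [l.NeBot] (hb : ∀ᶠ i in l, ∀ z ∈ S, |u i z| ≤ C) (hy : y ∈ S) :
    |lowerLimit l S u y| ≤ C := by
  rw [lowerLimit, abs_neg]
  exact abs_upperLimit_le (neg_bound hb) hy

theorem upperSemicontinuousOn_upperLimit [l.NeBot] (hb : ∀ᶠ i in l, ∀ z ∈ S, |u i z| ≤ C) :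
    UpperSemicontinuousOn (upperLimit l S u) S := by
  intro y _ c hc
  obtain ⟨c', h1, h2⟩ := exists_between hc
  obtain ⟨p, hp, q, hq, hpq⟩ := eventually_prod_iff.1 (eventually_lt_of_upperLimit_lt hb h1)
  have h3 : ∀ᶠ x in 𝓝[S] y, x ∈ S := self_mem_nhdsWithin
  filter_upwards [eventually_eventually_nhdsWithin.2 hq, h3] with x hx hxS
  refine (upperLimit_le hb hxS ?_).trans_lt h2
  filter_upwards [hp.prod_inl (𝓝[S] x), hx.prod_inr l] with r hr hr'
  exact (hpq hr hr').le

theorem lowerSemicontinuousOn_lowerLimit [l.NeBot] (hb : ∀ᶠ i in l, ∀ z ∈ S, |u i z| ≤ C) :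
    LowerSemicontinuousOn (lowerLimit l S u) S := by
  intro y hy c hc
  have := upperSemicontinuousOn_upperLimit (neg_bound hb) y hy (-c) (by
    rw [lowerLimit] at hc; linarith)
  filter_upwards [this] with x hx
  rw [lowerLimit]; linarith

/-- A limit of values of `u` along any filter approaching `y` lies below the upper limit. -/
theorem le_upperLimit_of_tendsto {κ : Type*} {G : Filter κ} [G.NeBot]
    (hb : ∀ᶠ i in l, ∀ z ∈ S, |u i z| ≤ C) {a : κ → ι} {z : κ → X} (ha : Tendsto a G l)
    (hz : Tendsto z G (𝓝[S] y)) {r : κ → ℝ} {r₀ : ℝ} (hr : Tendsto r G (𝓝 r₀))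
    (hle : ∀ᶠ k in G, r k ≤ u (a k) (z k)) : r₀ ≤ upperLimit l S u y := by
  refine le_of_forall_gt_imp_ge_of_dense fun c hc => ?_
  refine le_of_tendsto hr ?_
  filter_upwards [hle, (ha.prodMk hz).eventually (eventually_lt_of_upperLimit_lt hb hc)] with k h1 h2
  exact h1.trans h2.le

theorem lowerLimit_le_of_tendsto {κ : Type*} {G : Filter κ} [G.NeBot]
    (hb : ∀ᶠ i in l, ∀ z ∈ S, |u i z| ≤ C) {a : κ → ι} {z : κ → X} (ha : Tendsto a G l)
    (hz : Tendsto z G (𝓝[S] y)) {r : κ → ℝ} {r₀ : ℝ} (hr : Tendsto r G (𝓝 r₀))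
    (hle : ∀ᶠ k in G, u (a k) (z k) ≤ r k) : lowerLimit l S u y ≤ r₀ := by
  have := le_upperLimit_of_tendsto (neg_bound hb) ha hz hr.neg (hle.mono fun k hk => neg_le_neg hk)
  rw [lowerLimit]; linarith

theorem lowerLimit_le_upperLimit [l.NeBot] (hb : ∀ᶠ i in l, ∀ z ∈ S, |u i z| ≤ C) (hy : y ∈ S) :
    lowerLimit l S u y ≤ upperLimit l S u y := by
  have := mem_closure_iff_nhdsWithin_neBot.1 (subset_closure hy)
  by_contra! h
  obtain ⟨c, h1, h2⟩ := exists_between h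
  have h3 := eventually_lt_of_upperLimit_lt hb h1
  have h4 : upperLimit l S (fun i z => -u i z) y < -c := by rw [lowerLimit] at h2; linarith
  obtain ⟨q, hq, hq'⟩ := (h3.and (eventually_lt_of_upperLimit_lt (neg_bound hb) h4)).exists
  linarith

/-- The upper limit is attained along an ultrafilter. -/
theorem exists_ultrafilter_tendsto_upperLimit [l.NeBot] (hb : ∀ᶠ i in l, ∀ z ∈ S, |u i z| ≤ C)
    (hy : y ∈ S) : ∃ G : Ultrafilter (ι × X), Tendsto Prod.fst (G : Filter (ι × X)) l ∧
      Tendsto Prod.snd (G : Filter (ι × X)) (𝓝[S] y) ∧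
      Tendsto (fun q : ι × X => u q.1 q.2) G (𝓝 (upperLimit l S u y)) := by
  have h : MapClusterPt (upperLimit l S u y) (l ×ˢ 𝓝[S] y) (fun q : ι × X => u q.1 q.2) := by
    refine mapClusterPt_iff_frequently.2 fun s hs => ?_
    obtain ⟨ε, hε, hs⟩ := Metric.mem_nhds_iff.1 hs
    have h1 : ∃ᶠ q : ι × X in l ×ˢ 𝓝[S] y, upperLimit l S u y - ε < u q.1 q.2 :=
      frequently_lt_of_lt_limsup (isCoboundedUnder_prod hb hy) (sub_lt_self _ hε)
    have h2 := eventually_lt_of_upperLimit_lt (y := y) hb (lt_add_of_pos_right _ hε)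
    refine (h1.and_eventually h2).mono fun q hq => hs ?_
    rw [Metric.mem_ball, Real.dist_eq, abs_lt]
    constructor <;> linarith [hq.1, hq.2]
  obtain ⟨G, hG, hG'⟩ := mapClusterPt_iff_ultrafilter.1 h
  exact ⟨G, tendsto_fst.mono_left hG, tendsto_snd.mono_left hG, hG'⟩

/-- If the two half-relaxed limits agree, the family converges locally uniformly. -/
theorem tendstoLocallyUniformlyOn_of_relaxedLimits [l.NeBot]
    (hb : ∀ᶠ i in l, ∀ z ∈ S, |u i z| ≤ C) {V : X → ℝ} (hU : EqOn (upperLimit l S u) V S)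
    (hL : EqOn (lowerLimit l S u) V S) : TendstoLocallyUniformlyOn u V l S := by
  rw [Metric.tendstoLocallyUniformlyOn_iff]
  intro ε hε y hy
  have h1 := eventually_lt_of_upperLimit_lt (y := y) (c := V y + ε / 2) hb
    (by rw [hU hy]; linarith)
  have h2 := eventually_lt_of_upperLimit_lt (y := y) (c := -V y + ε / 2) (neg_bound hb) (by
    have := hL hy; rw [lowerLimit] at this; linarith)
  have h3 : ∀ᶠ x in 𝓝[S] y, upperLimit l S u x < V y + ε / 2 :=
    upperSemicontinuousOn_upperLimit hb y hy _ (by simp only [hU hy]; linarith)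
  have h4 : ∀ᶠ x in 𝓝[S] y, V y - ε / 2 < lowerLimit l S u x :=
    lowerSemicontinuousOn_lowerLimit hb y hy _ (by simp only [hL hy]; linarith)
  have h5 : ∀ᶠ x in 𝓝[S] y, x ∈ S := self_mem_nhdsWithin
  obtain ⟨p, hp, q, hq, hpq⟩ := eventually_prod_iff.1 (h1.and h2)
  refine ⟨_, hq.and (h3.and (h4.and h5)), ?_⟩
  filter_upwards [hp] with i hi x hx
  obtain ⟨hx1, hx2, hx3, hx4⟩ := hx
  obtain ⟨h6, h7⟩ := hpq hi hx1
  rw [hU hx4] at hx2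
  rw [hL hx4] at hx3
  simp only at h6 h7
  rw [Real.dist_eq, abs_lt]
  constructor <;> linarith

end RelaxedLimits

/-! ### Finite differences of smooth functions -/

/-- The second difference quotient is a second derivative at an intermediate point. -/
theorem exists_secondDifference_eq {f : ℝ → ℝ} (hf : ContDiff ℝ 2 f) (x : ℝ) {δ : ℝ} (hδ : 0 < δ) :
    ∃ ξ, |ξ - x| ≤ δ ∧ (f (x + δ) - 2 * f x + f (x - δ)) / δ ^ 2 = iteratedDeriv 2 f ξ := by
  have hd : Differentiable ℝ f := hf.differentiable (by norm_num)
  have hd' : Differentiable ℝ (deriv f) := by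
    have := (contDiff_succ_iff_deriv (n := 1)).1 (hf.of_le one_add_one_eq_two.le)
    exact this.2.2.differentiable (by norm_num)
  obtain ⟨η, hη, h1⟩ := exists_deriv_eq_slope (fun s => f (s + δ) - f s) (a := x - δ) (b := x)
    (by linarith) (by have := hd.continuous; fun_prop) (by fun_prop)
  have h2 : deriv (fun s => f (s + δ) - f s) η = deriv f (η + δ) - deriv f η := by
    rw [deriv_fun_sub (by fun_prop) (by fun_prop), deriv_comp_add_const]
  obtain ⟨ξ, hξ, h3⟩ := exists_deriv_eq_slope (deriv f) (a := η) (b := η + δ)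
    (by linarith) hd'.continuous.continuousOn hd'.differentiableOn
  refine ⟨ξ, abs_le.2 ⟨by linarith [hη.1, hξ.1], by linarith [hη.2, hξ.2]⟩, ?_⟩
  rw [iteratedDeriv_succ, iteratedDeriv_one, h3, ← h2, h1]
  simp only [sub_add_cancel, add_sub_cancel_left, sub_sub_cancel]
  field_simp
  ring

theorem deriv_snd_eq {ψ : ℝ × ℝ → ℝ} (hψ : Differentiable ℝ ψ) (p : ℝ × ℝ) :
    deriv (fun x => ψ (p.1, x)) p.2 = fderiv ℝ ψ p (0, 1) := by
  have h := (hψ p).hasFDerivAt.comp_hasDerivAt p.2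
    ((hasDerivAt_const p.2 p.1).prodMk (hasDerivAt_id p.2))
  exact h.deriv

theorem deriv_fst_eq {ψ : ℝ × ℝ → ℝ} (hψ : Differentiable ℝ ψ) (p : ℝ × ℝ) :
    deriv (fun s => ψ (s, p.2)) p.1 = fderiv ℝ ψ p (1, 0) := by
  have h := (hψ p).hasFDerivAt.comp_hasDerivAt p.1
    ((hasDerivAt_id p.1).prodMk (hasDerivAt_const p.1 p.2))
  exact h.deriv

theorem continuous_iteratedDeriv_snd {ψ : ℝ × ℝ → ℝ} (hψ : ContDiff ℝ 2 ψ) :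
    Continuous fun p : ℝ × ℝ => iteratedDeriv 2 (fun x => ψ (p.1, x)) p.2 := by
  have hd : Differentiable ℝ ψ := hψ.differentiable (by norm_num)
  have h1 : ContDiff ℝ 1 fun p : ℝ × ℝ => fderiv ℝ ψ p (0, 1) :=
    (hψ.fderiv_right (by norm_num)).clm_apply contDiff_const
  have h2 : ∀ p : ℝ × ℝ, iteratedDeriv 2 (fun x => ψ (p.1, x)) p.2
      = fderiv ℝ (fun p : ℝ × ℝ => fderiv ℝ ψ p (0, 1)) p (0, 1) := by
    intro p
    have h3 : deriv (fun x => ψ (p.1, x)) = fun x => fderiv ℝ ψ (p.1, x) (0, 1) :=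
      funext fun x => deriv_snd_eq hd (p.1, x)
    rw [iteratedDeriv_succ, iteratedDeriv_one, h3]
    exact deriv_snd_eq (h1.differentiable (by norm_num)) p
  simp only [h2]
  exact (h1.continuous_fderiv (by norm_num)).clm_apply continuous_const

theorem tendsto_secondDifference {κ : Type*} {G : Filter κ} {ψ : ℝ × ℝ → ℝ} (hψ : ContDiff ℝ 2 ψ)
    {p : κ → ℝ × ℝ} {δ : κ → ℝ} {y : ℝ × ℝ} (hp : Tendsto p G (𝓝 y)) (hδ : Tendsto δ G (𝓝 0))
    (hδ' : ∀ᶠ k in G, 0 < δ k) :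
    Tendsto (fun k => (ψ ((p k).1, (p k).2 + δ k) - 2 * ψ (p k) + ψ ((p k).1, (p k).2 - δ k))
      / δ k ^ 2) G (𝓝 (iteratedDeriv 2 (fun x => ψ (y.1, x)) y.2)) := by
  have h : ∀ k, ∃ ξ, 0 < δ k → |ξ - (p k).2| ≤ δ k ∧
      (ψ ((p k).1, (p k).2 + δ k) - 2 * ψ (p k) + ψ ((p k).1, (p k).2 - δ k)) / δ k ^ 2
        = iteratedDeriv 2 (fun x => ψ ((p k).1, x)) ξ := by
    intro k
    by_cases hk : 0 < δ k
    · obtain ⟨ξ, h1, h2⟩ := exists_secondDifference_eq (f := fun x => ψ ((p k).1, x))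
        (hψ.comp (contDiff_const.prodMk contDiff_id)) (p k).2 hk
      exact ⟨ξ, fun _ => ⟨h1, h2⟩⟩
    · exact ⟨0, fun h => absurd h hk⟩
  choose ξ hξ using h
  have h1 : Tendsto (fun k => ξ k - (p k).2) G (𝓝 0) :=
    squeeze_zero_norm' (hδ'.mono fun k hk => (hξ k hk).1) hδ
  have h2 : Tendsto (fun k => ((p k).1, ξ k)) G (𝓝 y) := by
    have h3 := h1.add ((continuous_snd.tendsto y).comp hp)
    simp only [Function.comp_def, sub_add_cancel, zero_add] at h3
    exact ((continuous_fst.tendsto y).comp hp).prodMk_nhds h3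
  exact (((continuous_iteratedDeriv_snd hψ).tendsto y).comp h2).congr'
    (hδ'.mono fun k hk => (hξ k hk).2.symm)

/-- First difference quotients `(ψ (p + δ e) - ψ p) / δ` with `p → y`, `δ → 0`, `e → e₀` converge to
the derivative of `ψ` at `y` in direction `e₀`. -/
theorem tendsto_firstDifference {κ : Type*} {G : Filter κ} {ψ : ℝ × ℝ → ℝ} (hψ : ContDiff ℝ 2 ψ)
    {p e : κ → ℝ × ℝ} {δ : κ → ℝ} {y e₀ : ℝ × ℝ} (hp : Tendsto p G (𝓝 y)) (hδ : Tendsto δ G (𝓝 0))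
    (hδ' : ∀ᶠ k in G, δ k ≠ 0) (he : Tendsto e G (𝓝 e₀)) :
    Tendsto (fun k => (ψ (p k + δ k • e k) - ψ (p k)) / δ k) G (𝓝 (fderiv ℝ ψ y e₀)) := by
  have hs := (hψ.contDiffAt (x := y)).hasStrictFDerivAt (by norm_num)
  have h0 : Tendsto (fun k => p k + δ k • e k) G (𝓝 y) := by
    simpa using hp.add (hδ.smul he)
  have h1 := hs.isLittleO.comp_tendsto (h0.prodMk_nhds hp)
  have h2 : (fun k => ψ (p k + δ k • e k) - ψ (p k) - fderiv ℝ ψ y (δ k • e k)) =o[G] δ := by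
    have h3 : (fun k => δ k • e k) =O[G] δ := by
      simpa using (Asymptotics.isBigO_refl δ G).smul (he.isBigO_one ℝ)
    refine Asymptotics.IsLittleO.trans_isBigO ?_ h3
    simpa [Function.comp_def] using h1
  have h4 := (h2.tendsto_div_nhds_zero).add (((fderiv ℝ ψ y).continuous.tendsto e₀).comp he)
  rw [zero_add] at h4
  refine h4.congr' (hδ'.mono fun k hk => ?_)
  simp only [Function.comp_apply, map_smul, smul_eq_mul]
  field_simp
  ring

end HJBQVI

namespace HJBQVI

/-! ### The grid -/

namespace Discretization

variable {W Y : Type*} [MetricSpace Y] {P : Problem W Y} (D : Discretization P)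

theorem neBot_mesh : (𝓝[D.H] (0 : ℝ)).NeBot := mem_closure_iff_nhdsWithin_neBot.1 D.H_zero

theorem eventually_mesh_mem : ∀ᶠ h in 𝓝[D.H] (0 : ℝ), h ∈ D.H := self_mem_nhdsWithin

theorem N_pos {h : ℝ} (hh : h ∈ D.H) : 0 < D.N h := by
  rcases Nat.eq_zero_or_pos (D.N h) with h0 | h0
  · have h1 := D.step_eq h hh
    have h2 := mul_pos D.cτ_pos (D.H_pos h hh)
    rw [h0, Nat.cast_zero, div_zero] at h1
    exact absurd h1 h2.ne
  · exact h0

theorem dt_pos {h : ℝ} (hh : h ∈ D.H) : 0 < D.dt h :=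
  div_pos P.T_pos (Nat.cast_pos.2 (D.N_pos hh))

theorem dx_pos {h : ℝ} (hh : h ∈ D.H) : 0 < D.dx h := mul_pos D.cx_pos (D.H_pos h hh)

theorem N_mul_dt {h : ℝ} (hh : h ∈ D.H) : D.N h * D.dt h = P.T := by
  have : (D.N h : ℝ) ≠ 0 := Nat.cast_ne_zero.2 (D.N_pos hh).ne'
  rw [dt]; field_simp

theorem tendsto_dt : Tendsto D.dt (𝓝[D.H] 0) (𝓝 0) := by
  have h1 : Tendsto (fun h : ℝ => D.cτ * h) (𝓝[D.H] 0) (𝓝 (D.cτ * 0)) :=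
    (tendsto_const_nhds.mul tendsto_id).mono_left nhdsWithin_le_nhds
  rw [mul_zero] at h1
  exact h1.congr' (D.eventually_mesh_mem.mono fun h hh => (D.step_eq h hh).symm)

theorem tendsto_dx : Tendsto D.dx (𝓝[D.H] 0) (𝓝 0) := by
  have h1 : Tendsto (fun h : ℝ => D.cx * h) (𝓝[D.H] 0) (𝓝 (D.cx * 0)) :=
    (tendsto_const_nhds.mul tendsto_id).mono_left nhdsWithin_le_nhds
  rwa [mul_zero] at h1

theorem tendsto_node_last : Tendsto (fun h => D.node h (D.M h)) (𝓝[D.H] 0) atTop := by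
  refine (D.width.atTop_mul_const (r := 1 / 2) (by norm_num)).congr fun h => ?_
  rw [node, dx]; ring

theorem tendsto_node_zero : Tendsto (fun h => D.node h 0) (𝓝[D.H] 0) atBot := by
  refine (tendsto_neg_atTop_atBot.comp D.tendsto_node_last).congr fun h => ?_
  simp only [Function.comp_apply, node, Nat.cast_zero]; ring

theorem time_zero (h : ℝ) : D.time h 0 = P.T := by simp [time]

theorem time_pred (h : ℝ) {n : ℕ} (hn : 1 ≤ n) : D.time h (n - 1) = D.time h n + D.dt h := by
  rw [time, time, Nat.cast_sub hn]; push_cast; ring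

theorem node_add_one (h : ℝ) (i : ℕ) : D.node h (i + 1) = D.node h i + D.dx h := by
  rw [node, node]; push_cast; ring

theorem node_sub_one (h : ℝ) {i : ℕ} (hi : 0 < i) : D.node h (i - 1) = D.node h i - D.dx h := by
  rw [node, node, Nat.cast_sub hi]; push_cast; ring

theorem node_eq (h : ℝ) (i : ℕ) : D.node h i = D.node h 0 + i * D.dx h := by
  rw [node, node]; push_cast; ring

theorem pt_mem_dom {h : ℝ} (hh : h ∈ D.H) {n : ℕ} (hn : n ≤ D.N h) (i : ℕ) :
    D.pt h n i ∈ P.dom := by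
  have h1 := D.dt_pos hh
  have h2 : (n : ℝ) * D.dt h ≤ P.T := by
    rw [← D.N_mul_dt hh]; gcongr
  have h3 : 0 ≤ (n : ℝ) * D.dt h := by positivity
  exact ⟨⟨by simp only [pt, time]; linarith, by simp only [pt, time]; linarith⟩, mem_univ _⟩

/-- Index of the time level that `extend` assigns to the point `y`. -/
noncomputable def timeIndex (h : ℝ) (y : ℝ × ℝ) : ℕ := min (D.N h) ⌈(P.T - y.1) / D.dt h - 1 / 2⌉₊

/-- Index of the spatial node that `extend` assigns to the point `y`. -/
noncomputable def nodeIndex (h : ℝ) (y : ℝ × ℝ) : ℕ :=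
  min (D.M h) ⌊(y.2 - D.node h 0) / D.dx h + 1 / 2⌋₊

theorem extend_pt {h : ℝ} (hh : h ∈ D.H) (v : ℕ → ℕ → ℝ) {n i : ℕ} (hn : n ≤ D.N h)
    (hi : i ≤ D.M h) : D.extend h v (D.pt h n i) = v n i := by
  have h1 := (D.dt_pos hh).ne'
  have h2 := (D.dx_pos hh).ne'
  have h3 : ⌈(P.T - D.time h n) / D.dt h - 1 / 2⌉₊ = n := by
    have : (P.T - D.time h n) / D.dt h = n := by rw [time]; field_simp; ring
    rw [this]
    refine le_antisymm (Nat.ceil_le.2 (by linarith)) ?_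
    rcases Nat.eq_zero_or_pos n with h0 | h0
    · omega
    · refine Nat.le_of_pred_lt ?_
      rw [Nat.pred_eq_sub_one, Nat.lt_ceil, Nat.cast_sub h0]; push_cast; linarith
  have h4 : ⌊(D.node h i - D.node h 0) / D.dx h + 1 / 2⌋₊ = i := by
    have : (D.node h i - D.node h 0) / D.dx h = i := by rw [D.node_eq h i]; field_simp; ring
    rw [this, Nat.floor_eq_iff (by positivity)]
    constructor <;> linarith
  rw [extend]
  simp only [pt]
  rw [h3, h4, min_eq_right hn, min_eq_right hi]

theorem abs_time_timeIndex_sub_le {h : ℝ} (hh : h ∈ D.H) {y : ℝ × ℝ} (hy : y ∈ P.dom) :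
    |D.time h (D.timeIndex h y) - y.1| ≤ D.dt h := by
  have h1 := D.dt_pos hh
  obtain ⟨⟨hy0, hyT⟩, -⟩ := hy
  set s := (P.T - y.1) / D.dt h with hs
  have h2 : y.1 = P.T - s * D.dt h := by rw [hs]; field_simp; ring
  have h3 : s ≤ D.N h := by rw [hs, div_le_iff₀ h1, D.N_mul_dt hh]; linarith
  have h4 : 0 ≤ s := div_nonneg (by linarith) h1.le
  have h5 : s - 1 / 2 ≤ ⌈s - 1 / 2⌉₊ := Nat.le_ceil _
  have h6 : (⌈s - 1 / 2⌉₊ : ℝ) ≤ s + 1 := by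
    rcases le_or_gt 0 (s - 1 / 2) with h | h
    · linarith [Nat.ceil_lt_add_one h]
    · rw [Nat.ceil_eq_zero.2 h.le]; push_cast; linarith
  have h7 : |s - D.timeIndex h y| ≤ 1 := by
    rw [timeIndex, ← hs, Nat.cast_min, abs_le]
    rcases min_choice (D.N h : ℝ) (⌈s - 1 / 2⌉₊ : ℝ) with hc | hc
    · have := min_le_right (D.N h : ℝ) (⌈s - 1 / 2⌉₊ : ℝ)
      constructor <;> linarith
    · rw [hc]; constructor <;> linarith
  rw [time, h2, show P.T - D.timeIndex h y * D.dt h - (P.T - s * D.dt h)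
    = (s - D.timeIndex h y) * D.dt h by ring, abs_mul, abs_of_pos h1]
  nlinarith

theorem abs_node_nodeIndex_sub_le {h : ℝ} (hh : h ∈ D.H) {y : ℝ × ℝ} (h0 : D.node h 0 ≤ y.2)
    (hM : y.2 ≤ D.node h (D.M h)) : |D.node h (D.nodeIndex h y) - y.2| ≤ D.dx h := by
  have h1 := D.dx_pos hh
  set s := (y.2 - D.node h 0) / D.dx h with hs
  have h2 : y.2 = D.node h 0 + s * D.dx h := by rw [hs]; field_simp; ring
  have h3 : s ≤ D.M h := by rw [hs, div_le_iff₀ h1]; rw [D.node_eq h (D.M h)] at hM; linarith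
  have h4 : 0 ≤ s := div_nonneg (by linarith) h1.le
  have h5 : (⌊s + 1 / 2⌋₊ : ℝ) ≤ s + 1 / 2 := Nat.floor_le (by linarith)
  have h6 : s + 1 / 2 < ⌊s + 1 / 2⌋₊ + 1 := Nat.lt_floor_add_one _
  have h7 : |(D.nodeIndex h y : ℝ) - s| ≤ 1 := by
    rw [nodeIndex, ← hs, Nat.cast_min, abs_le]
    rcases min_choice (D.M h : ℝ) (⌊s + 1 / 2⌋₊ : ℝ) with hc | hc
    · have := min_le_right (D.M h : ℝ) (⌊s + 1 / 2⌋₊ : ℝ)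
      constructor <;> linarith
    · rw [hc]; constructor <;> linarith
  rw [D.node_eq, h2, show D.node h 0 + D.nodeIndex h y * D.dx h - (D.node h 0 + s * D.dx h)
    = (D.nodeIndex h y - s) * D.dx h by ring, abs_mul, abs_of_pos h1]
  nlinarith

/-- `interp` is a convex combination of two nodal values whose weights and nodes do not depend on
the grid vector; inside of the grid the nodes are within `Δx` of `x` and average to `x`. -/
theorem exists_interp_eq {h : ℝ} (hh : h ∈ D.H) (x : ℝ) :
    ∃ (j j' : ℕ) (α : ℝ), j ≤ D.M h ∧ j' ≤ D.M h ∧ 0 ≤ α ∧ α ≤ 1 ∧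
      (∀ U : ℕ → ℝ, D.interp h U x = α * U j' + (1 - α) * U j) ∧
      (D.node h 0 < x → x < D.node h (D.M h) → x = α * D.node h j' + (1 - α) * D.node h j ∧
        |D.node h j - x| ≤ D.dx h ∧ |D.node h j' - x| ≤ D.dx h) := by
  have h1 := D.dx_pos hh
  by_cases hx0 : x ≤ D.node h 0
  · exact ⟨0, 0, 0, by simp, by simp, le_rfl, zero_le_one, fun U => by simp [interp, hx0],
      fun h => absurd h hx0.not_gt⟩
  by_cases hxM : D.node h (D.M h) ≤ x
  · exact ⟨D.M h, D.M h, 0, by simp, by simp, le_rfl, zero_le_one,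
      fun U => by simp [interp, hx0, hxM], fun _ h => absurd h hxM.not_gt⟩
  push Not at hx0 hxM
  set s := (x - D.node h 0) / D.dx h with hs
  have h2 : x = D.node h 0 + s * D.dx h := by rw [hs]; field_simp; ring
  have h3 : s < D.M h := by rw [hs, div_lt_iff₀ h1]; rw [D.node_eq h (D.M h)] at hxM; linarith
  have h4 : 0 ≤ s := div_nonneg (by linarith) h1.le
  have h5 : (⌊s⌋₊ : ℝ) ≤ s := Nat.floor_le h4
  have h6 : s < ⌊s⌋₊ + 1 := Nat.lt_floor_add_one _
  have h7 : ⌊s⌋₊ < D.M h := (Nat.floor_lt h4).2 h3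
  have h8 : (x - D.node h ⌊s⌋₊) / D.dx h = s - ⌊s⌋₊ := by
    rw [D.node_eq h ⌊s⌋₊, h2]; field_simp; ring
  refine ⟨⌊s⌋₊, ⌊s⌋₊ + 1, s - ⌊s⌋₊, h7.le, h7, by linarith, by linarith, fun U => ?_,
    fun _ _ => ⟨?_, ?_, ?_⟩⟩
  · simp only [interp, if_neg hx0.not_ge, if_neg hxM.not_ge, ← hs, h8]
  · rw [node_add_one, D.node_eq h ⌊s⌋₊, h2]; ring
  · rw [D.node_eq h ⌊s⌋₊, h2, abs_le]; constructor <;> nlinarith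
  · rw [node_add_one, D.node_eq h ⌊s⌋₊, h2, abs_le]; constructor <;> nlinarith

theorem interp_mono {h : ℝ} (hh : h ∈ D.H) {U U' : ℕ → ℝ} (hU : ∀ i ≤ D.M h, U i ≤ U' i) (x : ℝ) :
    D.interp h U x ≤ D.interp h U' x := by
  obtain ⟨j, j', α, hj, hj', h0, h1, he, -⟩ := D.exists_interp_eq hh x
  rw [he, he]
  have := hU j hj
  have := hU j' hj'
  have : 0 ≤ 1 - α := by linarith
  gcongr

theorem interp_const {h : ℝ} (hh : h ∈ D.H) (c x : ℝ) : D.interp h (fun _ => c) x = c := by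
  obtain ⟨j, j', α, hj, hj', h0, h1, he, -⟩ := D.exists_interp_eq hh x
  rw [he]; ring

/-- The grid points `(τ^n, x_i)` of the meshes `h`, all depending on a parameter that runs along the
filter `G`, converge to `y` as the meshes are refined. -/
structure Approx {κ : Type*} (G : Filter κ) (h : κ → ℝ) (n i : κ → ℕ) (y : ℝ × ℝ) : Prop where
  tendsto_mesh : Tendsto h G (𝓝[D.H] 0)
  n_le : ∀ᶠ k in G, n k ≤ D.N (h k)
  i_le : ∀ᶠ k in G, i k ≤ D.M (h k)
  tendsto_pt : Tendsto (fun k => D.pt (h k) (n k) (i k)) G (𝓝 y)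

variable {D} {κ : Type*} {G : Filter κ} {h : κ → ℝ} {n i : κ → ℕ} {y : ℝ × ℝ}

theorem eventually_between_ends (hh : Tendsto h G (𝓝[D.H] 0)) {x : κ → ℝ} {x₀ : ℝ}
    (hx : Tendsto x G (𝓝 x₀)) :
    ∀ᶠ k in G, D.node (h k) 0 < x k ∧ x k < D.node (h k) (D.M (h k)) := by
  filter_upwards [hx.eventually (lt_mem_nhds (sub_one_lt x₀)),
    hx.eventually (gt_mem_nhds (lt_add_one x₀)),
    (D.tendsto_node_zero.comp hh).eventually (eventually_le_atBot (x₀ - 1)),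
    (D.tendsto_node_last.comp hh).eventually (eventually_ge_atTop (x₀ + 1))] with k a b c d
  exact ⟨c.trans_lt a, b.trans_le d⟩

namespace Approx

section
variable (A : D.Approx G h n i y)
include A

theorem eventually_mem : ∀ᶠ k in G, h k ∈ D.H := A.tendsto_mesh.eventually D.eventually_mesh_mem

theorem tendsto_dt : Tendsto (fun k => D.dt (h k)) G (𝓝 0) := D.tendsto_dt.comp A.tendsto_mesh

theorem tendsto_dx : Tendsto (fun k => D.dx (h k)) G (𝓝 0) := D.tendsto_dx.comp A.tendsto_mesh

theorem tendsto_time : Tendsto (fun k => D.time (h k) (n k)) G (𝓝 y.1) :=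
  (continuous_fst.tendsto y).comp A.tendsto_pt

theorem tendsto_node : Tendsto (fun k => D.node (h k) (i k)) G (𝓝 y.2) :=
  (continuous_snd.tendsto y).comp A.tendsto_pt

theorem tendsto_pt_within : Tendsto (fun k => D.pt (h k) (n k) (i k)) G (𝓝[P.dom] y) := by
  refine tendsto_nhdsWithin_iff.2 ⟨A.tendsto_pt, ?_⟩
  filter_upwards [A.eventually_mem, A.n_le] with k h1 h2
  exact D.pt_mem_dom h1 h2 _

theorem eventually_interior : ∀ᶠ k in G, 0 < i k ∧ i k < D.M (h k) := by
  filter_upwards [eventually_between_ends A.tendsto_mesh A.tendsto_node, A.i_le] with k h1 h2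
  refine ⟨Nat.pos_of_ne_zero fun h0 => ?_, lt_of_le_of_ne h2 fun h0 => ?_⟩
  · rw [h0] at h1; exact h1.1.false
  · rw [h0] at h1; exact h1.2.false

theorem add_one : D.Approx G h n (fun k => i k + 1) y where
  tendsto_mesh := A.tendsto_mesh
  n_le := A.n_le
  i_le := A.eventually_interior.mono fun _ hk => hk.2
  tendsto_pt := by
    refine A.tendsto_time.prodMk_nhds ?_
    simp only [node_add_one]
    simpa using A.tendsto_node.add A.tendsto_dx

theorem sub_one : D.Approx G h n (fun k => i k - 1) y where
  tendsto_mesh := A.tendsto_mesh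
  n_le := A.n_le
  i_le := A.i_le.mono fun _ hk => (Nat.sub_le _ _).trans hk
  tendsto_pt := by
    refine A.tendsto_time.prodMk_nhds ?_
    have h1 : Tendsto (fun k => D.node (h k) (i k) - D.dx (h k)) G (𝓝 y.2) := by
      simpa using A.tendsto_node.sub A.tendsto_dx
    exact h1.congr' (A.eventually_interior.mono fun k hk => (D.node_sub_one _ hk.1).symm)

theorem pred_time (hn : ∀ᶠ k in G, 1 ≤ n k) : D.Approx G h (fun k => n k - 1) i y where
  tendsto_mesh := A.tendsto_mesh
  n_le := A.n_le.mono fun _ hk => (Nat.sub_le _ _).trans hk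
  i_le := A.i_le
  tendsto_pt := by
    have h1 : Tendsto (fun k => D.time (h k) (n k) + D.dt (h k)) G (𝓝 y.1) := by
      simpa using A.tendsto_time.add A.tendsto_dt
    exact (h1.congr' (hn.mono fun k hk => (D.time_pred _ hk).symm)).prodMk_nhds A.tendsto_node

theorem ite {i' : κ → ℕ} (p : κ → Prop) [DecidablePred p] (A' : D.Approx G h n i' y) :
    D.Approx G h n (fun k => if p k then i k else i' k) y where
  tendsto_mesh := A.tendsto_mesh
  n_le := A.n_le
  i_le := by
    filter_upwards [A.i_le, A'.i_le] with k ha hb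
    split_ifs <;> assumption
  tendsto_pt := by
    refine (Tendsto.if' (p := p) A.tendsto_pt A'.tendsto_pt).congr fun k => ?_
    split_ifs <;> rfl

/-- The nodes used by `interp` at points `x k → x₀` converge to `x₀`. -/
theorem exists_interp {x : κ → ℝ} {x₀ : ℝ} (hx : Tendsto x G (𝓝 x₀)) :
    ∃ (j j' : κ → ℕ) (α : κ → ℝ), D.Approx G h n j (y.1, x₀) ∧ D.Approx G h n j' (y.1, x₀) ∧
      ∀ᶠ k in G, 0 ≤ α k ∧ α k ≤ 1 ∧
        x k = α k * D.node (h k) (j' k) + (1 - α k) * D.node (h k) (j k) ∧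
        |D.node (h k) (j k) - x k| ≤ D.dx (h k) ∧ |D.node (h k) (j' k) - x k| ≤ D.dx (h k) ∧
        ∀ U : ℕ → ℝ, D.interp (h k) U (x k) = α k * U (j' k) + (1 - α k) * U (j k) := by
  have H : ∀ k, ∃ (j j' : ℕ) (α : ℝ), h k ∈ D.H → j ≤ D.M (h k) ∧ j' ≤ D.M (h k) ∧ 0 ≤ α ∧ α ≤ 1 ∧
      (∀ U : ℕ → ℝ, D.interp (h k) U (x k) = α * U j' + (1 - α) * U j) ∧
      (D.node (h k) 0 < x k → x k < D.node (h k) (D.M (h k)) →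
        x k = α * D.node (h k) j' + (1 - α) * D.node (h k) j ∧
        |D.node (h k) j - x k| ≤ D.dx (h k) ∧ |D.node (h k) j' - x k| ≤ D.dx (h k)) := by
    intro k
    by_cases hk : h k ∈ D.H
    · obtain ⟨j, j', α, hj⟩ := D.exists_interp_eq hk (x k)
      exact ⟨j, j', α, fun _ => hj⟩
    · exact ⟨0, 0, 0, fun h => absurd h hk⟩
  choose j j' α H using H
  have hb := eventually_between_ends A.tendsto_mesh hx
  have key : ∀ m : κ → ℕ, (∀ᶠ k in G, m k ≤ D.M (h k)) →
      (∀ᶠ k in G, |D.node (h k) (m k) - x k| ≤ D.dx (h k)) → D.Approx G h n m (y.1, x₀) := by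
    refine fun m h1 h2 => ⟨A.tendsto_mesh, A.n_le, h1, A.tendsto_time.prodMk_nhds ?_⟩
    have h3 := (squeeze_zero_norm' (f := fun k => D.node (h k) (m k) - x k) h2 A.tendsto_dx).add hx
    simpa using h3
  refine ⟨j, j', α, key j ?_ ?_, key j' ?_ ?_, ?_⟩
  · filter_upwards [A.eventually_mem] with k hk using (H k hk).1
  · filter_upwards [A.eventually_mem, hb] with k hk hk'
    exact ((H k hk).2.2.2.2.2 hk'.1 hk'.2).2.1
  · filter_upwards [A.eventually_mem] with k hk using (H k hk).2.1
  · filter_upwards [A.eventually_mem, hb] with k hk hk'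
    exact ((H k hk).2.2.2.2.2 hk'.1 hk'.2).2.2
  · filter_upwards [A.eventually_mem, hb] with k hk hk'
    obtain ⟨-, -, h0, h1, h2, h3⟩ := H k hk
    obtain ⟨h4, h5, h6⟩ := h3 hk'.1 hk'.2
    exact ⟨h0, h1, h4, h5, h6, h2⟩

end

end Approx

/-- Replacing points `z k → y` by the nearest grid points does not change the limit. -/
theorem approx_nearest (hh : Tendsto h G (𝓝[D.H] 0)) {z : κ → ℝ × ℝ}
    (hz : Tendsto z G (𝓝[P.dom] y)) :
    D.Approx G h (fun k => D.timeIndex (h k) (z k)) (fun k => D.nodeIndex (h k) (z k)) y := by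
  obtain ⟨hz1, hz2⟩ := tendsto_nhdsWithin_iff.1 hz
  have hm := hh.eventually D.eventually_mesh_mem
  have ht := (continuous_fst.tendsto y).comp hz1
  have hx := (continuous_snd.tendsto y).comp hz1
  refine ⟨hh, .of_forall fun k => min_le_left _ _, .of_forall fun k => min_le_left _ _,
    Tendsto.prodMk_nhds ?_ ?_⟩
  · have h1 := squeeze_zero_norm'
      (f := fun k => D.time (h k) (D.timeIndex (h k) (z k)) - (z k).1)
      ((hm.and hz2).mono fun k hk => D.abs_time_timeIndex_sub_le hk.1 hk.2) (D.tendsto_dt.comp hh)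
    simpa using h1.add ht
  · have h1 := squeeze_zero_norm'
      (f := fun k => D.node (h k) (D.nodeIndex (h k) (z k)) - (z k).2)
      ((hm.and (eventually_between_ends hh hx)).mono fun k hk =>
        D.abs_node_nodeIndex_sub_le hk.1 hk.2.1.le hk.2.2.le) (D.tendsto_dx.comp hh)
    simpa using h1.add hx

end Discretization

end HJBQVI

namespace HJBQVI

/-! ### Semicontinuous envelopes of the HJBQVI operator -/

namespace Problem

variable {W Y : Type*} [MetricSpace Y] (P : Problem W Y)

/-- The Hamiltonian `½ b² A + a p + f` at the point `y` for a fixed control `w`. -/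
noncomputable def ham (y : ℝ × ℝ) (w : W) (p A : ℝ) : ℝ :=
  1 / 2 * P.b y w ^ 2 * A + P.a y w * p + P.f y w

theorem F_eq_of_lt {y : ℝ × ℝ} (hy : y.1 < P.T) (r q p A ℓ : ℝ) :
    P.F (y, r, (q, p), A, ℓ) = min (-q - supOn univ fun w => P.ham y w p A) (r - ℓ) :=
  if_pos hy

theorem F_eq_of_le {y : ℝ × ℝ} (hy : P.T ≤ y.1) (r q p A ℓ : ℝ) :
    P.F (y, r, (q, p), A, ℓ) = min (r - P.g y.2) (r - ℓ) :=
  if_neg hy.not_gt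

theorem F_le (x : (ℝ × ℝ) × ℝ × (ℝ × ℝ) × ℝ × ℝ) : P.F x ≤ x.2.1 - x.2.2.2.2 := by
  obtain ⟨y, r, ⟨q, p⟩, A, ℓ⟩ := x
  rcases lt_or_ge y.1 P.T with h | h
  · rw [P.F_eq_of_lt h]; exact min_le_right _ _
  · rw [P.F_eq_of_le h]; exact min_le_right _ _

variable {P} [MetricSpace W]

theorem continuousOn_ham (h1 : P.H1) :
    ContinuousOn (fun q : ((ℝ × ℝ) × ℝ × (ℝ × ℝ) × ℝ × ℝ) × W =>
      P.ham q.1.1 q.2 q.1.2.2.1.2 q.1.2.2.2.1) (P.domF ×ˢ univ) := by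
  have hm : ContinuousOn (fun q : ((ℝ × ℝ) × ℝ × (ℝ × ℝ) × ℝ × ℝ) × W => (q.1.1, q.2))
      (P.domF ×ˢ univ) := by fun_prop
  have hs : MapsTo (fun q : ((ℝ × ℝ) × ℝ × (ℝ × ℝ) × ℝ × ℝ) × W => (q.1.1, q.2))
      (P.domF ×ˢ univ) (P.dom ×ˢ univ) := fun q hq => ⟨hq.1.1, mem_univ _⟩
  have ha := h1.continuous_a.comp hm hs
  have hb := h1.continuous_b.comp hm hs
  have hf := h1.continuous_f.comp hm hs
  simp only [Function.comp_def] at ha hb hf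
  unfold ham
  fun_prop

theorem continuousOn_ham_left (h1 : P.H1) (w : W) :
    ContinuousOn (fun x : (ℝ × ℝ) × ℝ × (ℝ × ℝ) × ℝ × ℝ => P.ham x.1 w x.2.2.1.2 x.2.2.2.1)
      P.domF :=
  (continuousOn_ham h1).comp (f := fun x => (x, w)) (by fun_prop) fun _ hx => ⟨hx, mem_univ _⟩

variable [CompactSpace W]

/-- A strict upper bound of the Hamiltonian, uniform in the control, persists nearby. -/
theorem eventually_ham_lt (h1 : P.H1) {x : (ℝ × ℝ) × ℝ × (ℝ × ℝ) × ℝ × ℝ} (hx : x ∈ P.domF) {c : ℝ}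
    (hc : ∀ w, P.ham x.1 w x.2.2.1.2 x.2.2.2.1 < c) :
    ∀ᶠ x' in 𝓝[P.domF] x, ∀ w, P.ham x'.1 w x'.2.2.1.2 x'.2.2.2.1 < c := by
  have key : ∀ᶠ x' in 𝓝 x, ∀ w ∈ (univ : Set W), x' ∈ P.domF →
      P.ham x'.1 w x'.2.2.1.2 x'.2.2.2.1 < c := by
    refine isCompact_univ.eventually_forall_of_forall_eventually fun w _ => ?_
    have h2 := (continuousOn_ham h1 (x, w) ⟨hx, mem_univ _⟩).eventually (gt_mem_nhds (hc w))
    refine (eventually_nhdsWithin_iff.1 h2).mono fun z hz hz' => hz ⟨hz', mem_univ _⟩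
  exact eventually_nhdsWithin_iff.2 (key.mono fun x' h hx' w => h w (mem_univ _) hx')

theorem exists_ham_lt (h1 : P.H1) {x : (ℝ × ℝ) × ℝ × (ℝ × ℝ) × ℝ × ℝ} (hx : x ∈ P.domF) :
    ∃ c, ∀ w, P.ham x.1 w x.2.2.1.2 x.2.2.2.1 < c := by
  have hc : Continuous fun w => P.ham x.1 w x.2.2.1.2 x.2.2.2.1 :=
    (continuousOn_ham h1).comp_continuous (f := fun w : W => (x, w)) (by fun_prop)
      fun w => ⟨hx, mem_univ _⟩
  obtain ⟨c, hc⟩ := (isCompact_range hc).bddAbove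
  exact ⟨c + 1, fun w => (hc (mem_range_self w)).trans_lt (lt_add_one c)⟩

theorem ham_le_supOn (h1 : P.H1) {y : ℝ × ℝ} (hy : y ∈ P.dom) (p A : ℝ) (w : W) :
    P.ham y w p A ≤ supOn univ fun w => P.ham y w p A := by
  obtain ⟨c, hc⟩ := exists_ham_lt h1 (x := (y, 0, (0, p), A, 0)) ⟨hy, mem_univ _⟩
  exact le_csSup ⟨c, by rintro _ ⟨w, -, rfl⟩; exact (hc w).le⟩ ⟨w, mem_univ _, rfl⟩

variable [Nonempty W]

omit [MetricSpace W] [CompactSpace W] in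
theorem supOn_ham_le {y : ℝ × ℝ} {p A c : ℝ} (hc : ∀ w, P.ham y w p A ≤ c) :
    (supOn univ fun w => P.ham y w p A) ≤ c :=
  csSup_le (univ_nonempty.image _) (by rintro _ ⟨w, -, rfl⟩; exact hc w)

theorem isBoundedUnder_ge_F (h1 : P.H1) {x : (ℝ × ℝ) × ℝ × (ℝ × ℝ) × ℝ × ℝ} (hx : x ∈ P.domF) :
    IsBoundedUnder (· ≥ ·) (𝓝[P.domF] x) P.F := by
  obtain ⟨c, hc⟩ := exists_ham_lt h1 hx
  let m : (ℝ × ℝ) × ℝ × (ℝ × ℝ) × ℝ × ℝ → ℝ := fun x =>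
    min (min (-x.2.2.1.1 - c) (x.2.1 - P.g x.1.2)) (x.2.1 - x.2.2.2.2)
  have hm : Continuous m := by
    have := h1.continuous_g
    fun_prop
  have h2 : ∀ᶠ x' in 𝓝[P.domF] x, m x - 1 < m x' :=
    (hm.continuousAt.mono_left nhdsWithin_le_nhds).eventually (lt_mem_nhds (sub_one_lt _))
  refine ⟨m x - 1, ?_⟩
  rw [eventually_map]
  filter_upwards [h2, eventually_ham_lt h1 hx hc] with x' h3 h4
  refine h3.le.trans ?_
  obtain ⟨y, r, ⟨q, p⟩, A, ℓ⟩ := x'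
  rcases lt_or_ge y.1 P.T with h | h
  · rw [P.F_eq_of_lt h]
    exact min_le_min_right _ ((min_le_left _ _).trans
      (sub_le_sub_left (supOn_ham_le fun w => (h4 w).le) _))
  · rw [P.F_eq_of_le h]
    exact min_le_min_right _ (min_le_right _ _)

omit [MetricSpace W] [CompactSpace W] [Nonempty W] in
theorem isBoundedUnder_le_F (x : (ℝ × ℝ) × ℝ × (ℝ × ℝ) × ℝ × ℝ) :
    IsBoundedUnder (· ≤ ·) (𝓝[P.domF] x) P.F := by
  have hm : Continuous fun x : (ℝ × ℝ) × ℝ × (ℝ × ℝ) × ℝ × ℝ => x.2.1 - x.2.2.2.2 := by fun_prop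
  have h2 : ∀ᶠ x' in 𝓝[P.domF] x, x'.2.1 - x'.2.2.2.2 < x.2.1 - x.2.2.2.2 + 1 :=
    (hm.continuousAt.mono_left nhdsWithin_le_nhds).eventually (gt_mem_nhds (lt_add_one _))
  exact ⟨x.2.1 - x.2.2.2.2 + 1, eventually_map.2 (h2.mono fun x' h => (P.F_le x').trans h.le)⟩

omit [MetricSpace W] [CompactSpace W] [Nonempty W] in
/-- Every point of the domain is a limit of points with `t < T`; this is what makes the interior
branch of `F` contribute to both envelopes at `t = T`. -/
theorem tendsto_shrink {y : ℝ × ℝ} (hy : y ∈ P.dom) (e : ℝ × (ℝ × ℝ) × ℝ × ℝ) :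
    Tendsto (fun s : ℝ => ((y.1 * s, y.2), e)) (𝓝[<] 1) (𝓝[P.domF] (y, e)) ∧
      ∀ᶠ s : ℝ in 𝓝[<] 1, (y.1 * s, y.2) ∈ P.dom ∧ y.1 * s < P.T := by
  obtain ⟨⟨h0, hT⟩, -⟩ := hy
  have h2 : ∀ᶠ s : ℝ in 𝓝[<] 1, (y.1 * s, y.2) ∈ P.dom ∧ y.1 * s < P.T := by
    filter_upwards [self_mem_nhdsWithin,
      mem_nhdsWithin_of_mem_nhds (lt_mem_nhds (zero_lt_one (α := ℝ)))] with s hs1 hs0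
    rw [mem_Iio] at hs1
    have h3 : y.1 * s < P.T := by nlinarith [P.T_pos]
    exact ⟨⟨⟨by positivity, h3.le⟩, mem_univ _⟩, h3⟩
  refine ⟨tendsto_nhdsWithin_iff.2 ⟨?_, h2.mono fun s hs => ⟨hs.1, mem_univ _⟩⟩, h2⟩
  have h4 : Continuous fun s : ℝ => ((y.1 * s, y.2), e) := by fun_prop
  have h5 := h4.tendsto 1
  simp only [mul_one] at h5
  exact h5.mono_left nhdsWithin_le_nhds

theorem Flower_nonpos (h1 : P.H1) {y : ℝ × ℝ} (hy : y ∈ P.dom) {r q p A ℓ : ℝ}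
    (h : r ≤ ℓ ∨ (∃ w, 0 ≤ q + P.ham y w p A) ∨ (y.1 = P.T ∧ r ≤ P.g y.2)) :
    P.Flower (y, r, (q, p), A, ℓ) ≤ 0 := by
  have hx : (y, r, (q, p), A, ℓ) ∈ P.domF := ⟨hy, mem_univ _⟩
  have key : (∀ ε > 0, ∃ᶠ x in 𝓝[P.domF] (y, r, (q, p), A, ℓ), P.F x ≤ ε) →
      P.Flower (y, r, (q, p), A, ℓ) ≤ 0 := fun h => le_of_forall_pos_le_add fun ε hε => by
    rw [zero_add]
    exact liminf_le_of_frequently_le (h ε hε) (isBoundedUnder_ge_F h1 hx)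
  have hpure := pure_le_nhdsWithin hx
  rcases h with h | ⟨w, hw⟩ | ⟨hT, h⟩
  · refine key fun ε hε => Frequently.filter_mono (frequently_pure.2 ?_) hpure
    exact (P.F_le _).trans (by simp only; linarith)
  · refine key fun ε hε => ?_
    obtain ⟨h2, h3⟩ := tendsto_shrink hy (r, (q, p), A, ℓ)
    have h4 : Tendsto (fun s : ℝ => P.ham (y.1 * s, y.2) w p A) (𝓝[<] 1) (𝓝 (P.ham y w p A)) := by
      have h5 := (continuousOn_ham_left h1 w).continuousWithinAt hx
      have h6 := Filter.Tendsto.comp h5 h2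
      simpa only [Function.comp_def] using h6
    refine h2.frequently (Eventually.frequently ?_)
    filter_upwards [h3, h4.eventually (lt_mem_nhds (show -q - ε < P.ham y w p A by linarith))]
      with s hs hs'
    rw [P.F_eq_of_lt hs.2]
    refine (min_le_left _ _).trans ?_
    linarith [ham_le_supOn h1 hs.1 p A w]
  · refine key fun ε hε => Frequently.filter_mono (frequently_pure.2 ?_) hpure
    rw [P.F_eq_of_le hT.ge]
    exact (min_le_left _ _).trans (by linarith)

theorem Fupper_nonneg (h1 : P.H1) {y : ℝ × ℝ} (hy : y ∈ P.dom) {r q p A ℓ : ℝ} (hr : ℓ ≤ r)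
    (h : (∀ w, q + P.ham y w p A ≤ 0) ∨ (y.1 = P.T ∧ P.g y.2 ≤ r)) :
    0 ≤ P.Fupper (y, r, (q, p), A, ℓ) := by
  have hx : (y, r, (q, p), A, ℓ) ∈ P.domF := ⟨hy, mem_univ _⟩
  have key : (∀ ε > 0, ∃ᶠ x in 𝓝[P.domF] (y, r, (q, p), A, ℓ), -ε ≤ P.F x) →
      0 ≤ P.Fupper (y, r, (q, p), A, ℓ) := fun h => le_of_forall_pos_le_add fun ε hε => by
    have := le_limsup_of_frequently_le (h ε hε) (isBoundedUnder_le_F _)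
    rw [Fupper]; linarith
  rcases h with h | ⟨hT, h⟩
  · refine key fun ε hε => ?_
    obtain ⟨h2, h3⟩ := tendsto_shrink hy (r, (q, p), A, ℓ)
    have h4 := eventually_ham_lt h1 hx (c := -q + ε) fun w => by simp only; linarith [h w]
    refine h2.frequently (Eventually.frequently ?_)
    filter_upwards [h3, h2.eventually h4] with s hs hs'
    rw [P.F_eq_of_lt hs.2]
    have := supOn_ham_le (P := P) fun w => (hs' w).le
    exact le_min (by linarith) (by linarith)
  · refine key fun ε hε => Frequently.filter_mono (frequently_pure.2 ?_) (pure_le_nhdsWithin hx)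
    rw [P.F_eq_of_le hT.ge]
    exact le_min (by linarith) (by linarith)

end Problem

end HJBQVI

namespace HJBQVI

namespace Discretization

variable {W Y : Type*} [MetricSpace Y] {P : Problem W Y} (D : Discretization P)

/-! ### Half-relaxed limits of grid functions -/

/-- The grid functions `v h` are bounded uniformly in the mesh. -/
def UniformBound (v : ℝ → ℕ → ℕ → ℝ) (C : ℝ) : Prop :=
  ∀ h ∈ D.H, ∀ n ≤ D.N h, ∀ i ≤ D.M h, |v h n i| ≤ C

/-- Upper half-relaxed limit of a family of grid functions. -/
noncomputable def upper (v : ℝ → ℕ → ℕ → ℝ) : ℝ × ℝ → ℝ :=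
  upperLimit (𝓝[D.H] 0) P.dom fun h => D.extend h (v h)

/-- Lower half-relaxed limit of a family of grid functions. -/
noncomputable def lower (v : ℝ → ℕ → ℕ → ℝ) : ℝ × ℝ → ℝ :=
  lowerLimit (𝓝[D.H] 0) P.dom fun h => D.extend h (v h)

/-- Along the ultrafilter `G`, the grid points `(n k, i k)` of the meshes `h k` converge to `y`, the
grid values `v` there converge to `r`, and `v - ψ` is locally maximal there, in the sense that no
other grid points converging to `y` give larger values. -/
structure TouchesAbove {κ : Type*} (v : ℝ → ℕ → ℕ → ℝ) (ψ : ℝ × ℝ → ℝ) (G : Ultrafilter κ)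
    (h : κ → ℝ) (n i : κ → ℕ) (y : ℝ × ℝ) (r : ℝ) : Prop where
  approx : D.Approx G h n i y
  tendsto_val : Tendsto (fun k => v (h k) (n k) (i k)) G (𝓝 r)
  max : ∀ n' i' : κ → ℕ, D.Approx G h n' i' y → ∀ᶠ k in G,
    v (h k) (n' k) (i' k) - ψ (D.pt (h k) (n' k) (i' k))
      ≤ v (h k) (n k) (i k) - ψ (D.pt (h k) (n k) (i k))

/-- The mirror image of `TouchesAbove`: `v - ψ` is locally minimal. -/
def TouchesBelow {κ : Type*} (v : ℝ → ℕ → ℕ → ℝ) (ψ : ℝ × ℝ → ℝ) (G : Ultrafilter κ)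
    (h : κ → ℝ) (n i : κ → ℕ) (y : ℝ × ℝ) (r : ℝ) : Prop :=
  D.TouchesAbove (fun h n i => -v h n i) (fun z => -ψ z) G h n i y (-r)

variable {D} {v : ℝ → ℕ → ℕ → ℝ} {C : ℝ}

theorem UniformBound.extend (hb : D.UniformBound v C) :
    ∀ᶠ h in 𝓝[D.H] (0 : ℝ), ∀ z ∈ P.dom, |D.extend h (v h) z| ≤ C :=
  D.eventually_mesh_mem.mono fun h hh _ _ => hb h hh _ (min_le_left _ _) _ (min_le_left _ _)

theorem UniformBound.neg (hb : D.UniformBound v C) :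
    D.UniformBound (fun h n i => -v h n i) C := by
  simpa only [UniformBound, abs_neg] using hb

theorem le_upper_of_tendsto (hb : D.UniformBound v C) {κ : Type*} {G : Filter κ} [G.NeBot]
    {h : κ → ℝ} {n i : κ → ℕ} {y : ℝ × ℝ} (A : D.Approx G h n i y) {r : κ → ℝ} {r₀ : ℝ}
    (hr : Tendsto r G (𝓝 r₀)) (hle : ∀ᶠ k in G, r k ≤ v (h k) (n k) (i k)) :
    r₀ ≤ D.upper v y := by
  refine le_upperLimit_of_tendsto hb.extend A.tendsto_mesh A.tendsto_pt_within hr ?_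
  filter_upwards [hle, A.eventually_mem, A.n_le, A.i_le] with k h1 h2 h3 h4
  rwa [D.extend_pt h2 _ h3 h4]

theorem lower_le_of_tendsto (hb : D.UniformBound v C) {κ : Type*} {G : Filter κ} [G.NeBot]
    {h : κ → ℝ} {n i : κ → ℕ} {y : ℝ × ℝ} (A : D.Approx G h n i y) {r : κ → ℝ} {r₀ : ℝ}
    (hr : Tendsto r G (𝓝 r₀)) (hle : ∀ᶠ k in G, v (h k) (n k) (i k) ≤ r k) :
    D.lower v y ≤ r₀ := by
  refine lowerLimit_le_of_tendsto hb.extend A.tendsto_mesh A.tendsto_pt_within hr ?_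
  filter_upwards [hle, A.eventually_mem, A.n_le, A.i_le] with k h1 h2 h3 h4
  rwa [D.extend_pt h2 _ h3 h4]

/-! ### Perturbed test functions -/

/-- Adding a quartic centred at `y` makes a local extremum at `y` strict without changing the
second-order jet there. -/
theorem exists_strict_perturbation {φ : ℝ × ℝ → ℝ} (hφ : ContDiff ℝ 2 φ) (y : ℝ × ℝ) :
    ∃ Q : ℝ × ℝ → ℝ, ContDiff ℝ 2 Q ∧ Q y = 0 ∧ (∀ z, 0 ≤ Q z) ∧ (∀ z, Q z = 0 → z = y) ∧
      ∀ V : ℝ × ℝ → ℝ, P.jet V (fun z => φ z + Q z) y = P.jet V φ y := by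
  refine ⟨fun z => ((z.1 - y.1) ^ 2 + (z.2 - y.2) ^ 2) ^ 2, by fun_prop, by simp,
    fun z => by positivity, fun z hz => ?_, fun V => ?_⟩
  · have h1 := pow_eq_zero_iff (two_ne_zero) |>.1 hz
    have h2 : z.1 - y.1 = 0 := by nlinarith [sq_nonneg (z.1 - y.1), sq_nonneg (z.2 - y.2)]
    have h3 : z.2 - y.2 = 0 := by nlinarith [sq_nonneg (z.1 - y.1), sq_nonneg (z.2 - y.2)]
    exact Prod.ext (by linarith) (by linarith)
  · have hd : Differentiable ℝ φ := hφ.differentiable (by norm_num)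
    have hD : ∀ c x : ℝ, HasDerivAt (fun x : ℝ => (x - c) ^ 4) (4 * (x - c) ^ 3) x := fun c x => by
      simpa using ((hasDerivAt_id x).sub_const c).fun_pow 4
    have hD' : ∀ c : ℝ, deriv (fun x : ℝ => (x - c) ^ 4) = fun x => 4 * (x - c) ^ 3 :=
      fun c => funext fun x => (hD c x).deriv
    have e1 : ∀ s : ℝ, ((s - y.1) ^ 2 + (y.2 - y.2) ^ 2) ^ 2 = (s - y.1) ^ 4 := fun s => by ring
    have e2 : ∀ s : ℝ, ((y.1 - y.1) ^ 2 + (s - y.2) ^ 2) ^ 2 = (s - y.2) ^ 4 := fun s => by ring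
    simp only [Problem.jet, e1, e2]
    have h1 : deriv (fun s => φ (s, y.2) + (s - y.1) ^ 4) y.1 = deriv (fun s => φ (s, y.2)) y.1 := by
      rw [deriv_fun_add (by fun_prop) (by fun_prop), hD']; simp
    have h2 : deriv (fun s => φ (y.1, s) + (s - y.2) ^ 4) y.2 = deriv (fun s => φ (y.1, s)) y.2 := by
      rw [deriv_fun_add (by fun_prop) (by fun_prop), hD']; simp
    have h3 : iteratedDeriv 2 (fun s => φ (y.1, s) + (s - y.2) ^ 4) y.2
        = iteratedDeriv 2 (fun s => φ (y.1, s)) y.2 := by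
      rw [iteratedDeriv_fun_add (by fun_prop) (by fun_prop)]
      have : iteratedDeriv 2 (fun s : ℝ => (s - y.2) ^ 4) y.2 = 0 := by
        rw [iteratedDeriv_succ, iteratedDeriv_one, hD']
        simp
      rw [this, add_zero]
    rw [h1, h2, h3]

/-- Local maxima of `upper v - φ` are limits of local maxima of the grid functions, for a test
function with the same second-order jet. -/
theorem exists_touchesAbove (hb : D.UniformBound v C) {φ : ℝ × ℝ → ℝ} (hφ : ContDiff ℝ 2 φ)
    {y : ℝ × ℝ} (hy : y ∈ P.dom) (hmax : IsLocalMaxOn (fun z => D.upper v z - φ z) P.dom y) :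
    ∃ ψ : ℝ × ℝ → ℝ, ContDiff ℝ 2 ψ ∧ (∀ V, P.jet V ψ y = P.jet V φ y) ∧
      ∃ (G : Ultrafilter (ℝ × (ℝ × ℝ))) (h : ℝ × (ℝ × ℝ) → ℝ) (n i : ℝ × (ℝ × ℝ) → ℕ),
        D.TouchesAbove v ψ G h n i y (D.upper v y) := by
  have := D.neBot_mesh
  obtain ⟨Q, hQ, hQy, hQ0, hQ1, hjet⟩ := exists_strict_perturbation (P := P) hφ y
  refine ⟨_, hφ.add hQ, hjet, ?_⟩
  obtain ⟨G, hG1, hG2, hG3⟩ := exists_ultrafilter_tendsto_upperLimit hb.extend hy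
  set n₀ : ℝ × (ℝ × ℝ) → ℕ := fun k => D.timeIndex k.1 k.2 with hn₀
  set i₀ : ℝ × (ℝ × ℝ) → ℕ := fun k => D.nodeIndex k.1 k.2 with hi₀
  have A₀ : D.Approx (G : Filter (ℝ × (ℝ × ℝ))) Prod.fst n₀ i₀ y := approx_nearest hG1 hG2
  obtain ⟨ρ, hρ, hball⟩ : ∃ ρ > 0, ∀ z ∈ Metric.closedBall y ρ, z ∈ P.dom →
      D.upper v z - φ z ≤ D.upper v y - φ y := by
    obtain ⟨ρ, hρ, h1⟩ := Metric.nhds_basis_closedBall.eventually_iff.1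
      (eventually_nhdsWithin_iff.1 hmax)
    exact ⟨ρ, hρ, fun z hz hz' => h1 hz hz'⟩
  let S : ℝ → Set (ℕ × ℕ) := fun h =>
    {m | m.1 ≤ D.N h ∧ m.2 ≤ D.M h ∧ D.pt h m.1 m.2 ∈ Metric.closedBall y ρ}
  have hS : ∀ h, (S h).Finite := fun h =>
    ((finite_Iic (D.N h)).prod (finite_Iic (D.M h))).subset fun m hm => ⟨hm.1, hm.2.1⟩
  have hex : ∀ h, ∃ m, (S h).Nonempty → m ∈ S h ∧ ∀ m' ∈ S h,
      v h m'.1 m'.2 - (φ (D.pt h m'.1 m'.2) + Q (D.pt h m'.1 m'.2))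
        ≤ v h m.1 m.2 - (φ (D.pt h m.1 m.2) + Q (D.pt h m.1 m.2)) := by
    intro h
    by_cases hne : (S h).Nonempty
    · obtain ⟨m, hm, hm'⟩ := (S h).exists_max_image
        (fun m => v h m.1 m.2 - (φ (D.pt h m.1 m.2) + Q (D.pt h m.1 m.2))) (hS h) hne
      exact ⟨m, fun _ => ⟨hm, hm'⟩⟩
    · exact ⟨0, fun h => absurd h hne⟩
  choose m hm using hex
  have hmem : ∀ n' i', D.Approx (G : Filter (ℝ × (ℝ × ℝ))) Prod.fst n' i' y →
      ∀ᶠ k in (G : Filter (ℝ × (ℝ × ℝ))), (n' k, i' k) ∈ S k.1 := fun n' i' A => by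
    filter_upwards [A.n_le, A.i_le, A.tendsto_pt.eventually (Metric.closedBall_mem_nhds y hρ)]
      with k h1 h2 h3 using ⟨h1, h2, h3⟩
  have hS₀ := hmem n₀ i₀ A₀
  have hmS : ∀ᶠ k in (G : Filter (ℝ × (ℝ × ℝ))), m k.1 ∈ S k.1 :=
    hS₀.mono fun k hk => (hm k.1 ⟨_, hk⟩).1
  obtain ⟨z, hz, hGz⟩ := exists_tendsto_of_isCompact (isCompact_closedBall y ρ) G
    (f := fun k => D.pt k.1 (m k.1).1 (m k.1).2) (hmS.mono fun k hk => hk.2.2)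
  have A : D.Approx (G : Filter (ℝ × (ℝ × ℝ))) Prod.fst (fun k => (m k.1).1)
      (fun k => (m k.1).2) z :=
    ⟨hG1, hmS.mono fun k hk => hk.1, hmS.mono fun k hk => hk.2.1, hGz⟩
  obtain ⟨L, -, hL⟩ := exists_tendsto_of_isCompact (isCompact_Icc (a := -C) (b := C)) G
    (f := fun k => v k.1 (m k.1).1 (m k.1).2) (by
      filter_upwards [A.eventually_mem, hmS] with k h1 h2
      exact abs_le.1 (hb _ h1 _ h2.1 _ h2.2.1))
  have hzd : z ∈ P.dom := by
    have hc : IsClosed P.dom := isClosed_Icc.prod isClosed_univ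
    refine hc.mem_of_tendsto A.tendsto_pt ?_
    filter_upwards [A.eventually_mem, A.n_le] with k h1 h2 using D.pt_mem_dom h1 h2 _
  have hLz : L ≤ D.upper v z := le_upper_of_tendsto hb A hL (.of_forall fun _ => le_rfl)
  have hψ : Continuous fun z => φ z + Q z := (hφ.add hQ).continuous
  have hcmp : D.upper v y - (φ y + Q y) ≤ L - (φ z + Q z) := by
    refine le_of_tendsto_of_tendsto (hG3.sub ((hψ.tendsto y).comp A₀.tendsto_pt))
      (hL.sub ((hψ.tendsto z).comp A.tendsto_pt)) (hS₀.mono fun k hk => ?_)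
    exact (hm k.1 ⟨_, hk⟩).2 _ hk
  have hzy : z = y := hQ1 z (by linarith [hball z hz hzd, hQ0 z])
  subst hzy
  have hLU : L = D.upper v z := le_antisymm hLz (by linarith)
  refine ⟨G, Prod.fst, _, _, A, hLU ▸ hL, fun n' i' A' => ?_⟩
  filter_upwards [hmem n' i' A'] with k hk
  exact (hm k.1 ⟨_, hk⟩).2 _ hk

theorem exists_touchesBelow (hb : D.UniformBound v C) {φ : ℝ × ℝ → ℝ} (hφ : ContDiff ℝ 2 φ)
    {y : ℝ × ℝ} (hy : y ∈ P.dom) (hmin : IsLocalMinOn (fun z => D.lower v z - φ z) P.dom y) :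
    ∃ ψ : ℝ × ℝ → ℝ, ContDiff ℝ 2 ψ ∧ (∀ V, P.jet V ψ y = P.jet V φ y) ∧
      ∃ (G : Ultrafilter (ℝ × (ℝ × ℝ))) (h : ℝ × (ℝ × ℝ) → ℝ) (n i : ℝ × (ℝ × ℝ) → ℕ),
        D.TouchesBelow v ψ G h n i y (D.lower v y) := by
  have hU : D.upper (fun h n i => -v h n i) = fun z => -D.lower v z := by
    funext z; simp only [lower, lowerLimit, neg_neg]; rfl
  have hmax : IsLocalMaxOn (fun z => D.upper (fun h n i => -v h n i) z - (-φ z)) P.dom y := by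
    rw [hU]
    refine hmin.neg.congr (.of_forall fun z => ?_) hy
    simp only; ring
  obtain ⟨ψ, hψ, hjet, G, h, n, i, ht⟩ := exists_touchesAbove hb.neg hφ.neg hy hmax
  refine ⟨fun z => -ψ z, hψ.neg, fun V => ?_, G, h, n, i, ?_⟩
  · have h1 := hjet V
    simp only [Problem.jet, Prod.mk.injEq, true_and, and_true] at h1 ⊢
    have e : ∀ f : ℝ → ℝ, iteratedDeriv 2 (fun x => -f x) = fun x => -iteratedDeriv 2 f x :=
      fun f => funext fun x => iteratedDeriv_fun_neg 2 f x
    simp only [deriv.fun_neg, e] at h1 ⊢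
    obtain ⟨⟨h1, h2⟩, h3⟩ := h1
    refine ⟨⟨?_, ?_⟩, ?_⟩ <;> linarith
  · have h2 := congrFun hU y
    simp only [TouchesBelow, neg_neg]
    rwa [← h2]

end Discretization

end HJBQVI

namespace HJBQVI

/-! ### Suprema over controls and impulses -/

theorem exists_supOn_eq {α : Type*} {s : Set α} (hs : s.Finite) (hne : s.Nonempty) (f : α → ℝ) :
    ∃ a ∈ s, supOn s f = f a := by
  obtain ⟨a, ha, h⟩ := (hne.image f).csSup_mem (hs.image f)
  exact ⟨a, ha, h.symm⟩

theorem le_supOn {α : Type*} {s : Set α} (hs : s.Finite) (f : α → ℝ) {a : α} (ha : a ∈ s) :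
    f a ≤ supOn s f :=
  le_csSup (hs.image f).bddAbove (mem_image_of_mem f ha)

theorem supOn_le {α : Type*} {s : Set α} (hs : s.Nonempty) {f : α → ℝ} {c : ℝ}
    (h : ∀ a ∈ s, f a ≤ c) : supOn s f ≤ c :=
  csSup_le (hs.image f) (by rintro _ ⟨a, ha, rfl⟩; exact h a ha)

namespace Problem

variable {W Y : Type*} [MetricSpace Y] {P : Problem W Y}

theorem le_intervention (h3 : P.H3) {V : ℝ × ℝ → ℝ} {C : ℝ} (hV : ∀ y ∈ P.dom, V y ≤ C)
    {y : ℝ × ℝ} (hy : y ∈ P.dom) {z : Y} (hz : z ∈ (P.Z y : Set Y)) :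
    V (y.1, P.Γ y z) + P.K y z ≤ P.intervention V y := by
  obtain ⟨c, -, hc⟩ := h3
  refine le_csSup ⟨C + c, ?_⟩ (mem_image_of_mem _ hz)
  rintro _ ⟨z', hz', rfl⟩
  exact add_le_add (hV _ ⟨hy.1, mem_univ _⟩) (hc (y, z') ⟨hy, hz'⟩)

theorem intervention_congr {U V : ℝ × ℝ → ℝ} (hUV : EqOn U V P.dom) {y : ℝ × ℝ} (hy : y ∈ P.dom) :
    P.intervention U y = P.intervention V y := by
  rw [intervention, intervention, supOn, supOn]
  congr 1
  refine image_congr fun z _ => ?_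
  rw [@hUV (y.1, P.Γ y z) ⟨hy.1, mem_univ _⟩]

theorem IsSupersolution.congr {U V : ℝ × ℝ → ℝ} (hU : P.IsSupersolution U)
    (hUV : EqOn U V P.dom) : P.IsSupersolution V := by
  refine ⟨fun y hy c hc => ?_, fun φ hφ y hy hmin => ?_⟩
  · have h1 : ∀ᶠ x in 𝓝[P.dom] y, x ∈ P.dom := self_mem_nhdsWithin
    have h2 := hU.1 y hy c (by simp only [hUV hy]; exact hc)
    filter_upwards [h1, h2] with x hx hx'
    rwa [← hUV hx]
  · have h1 : ∀ᶠ x in 𝓝[P.dom] y, x ∈ P.dom := self_mem_nhdsWithin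
    have h2 := hU.2 φ hφ y hy (hmin.congr (h1.mono fun x hx => by simp only [hUV hx]) hy)
    rw [jet, intervention_congr hUV hy, hUV hy] at h2
    exact h2

end Problem

namespace Discretization

variable {W Y : Type*} [MetricSpace W] [MetricSpace Y] {P : Problem W Y} {D : Discretization P}
  {v : ℝ → ℕ → ℕ → ℝ} {C : ℝ}

section Intervention

variable {κ : Type*} {h : κ → ℝ} {n m i : κ → ℕ} {y : ℝ × ℝ}

theorem tendsto_Zh (h4 : D.H4) {G : Filter κ} (A : D.Approx G h n i y) (hy : y ∈ P.dom) :
    Tendsto (fun k => D.Zh (h k) (D.pt (h k) (n k) (i k))) G (𝓝 (P.Z y)) := by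
  have := D.neBot_mesh
  have hc : ContinuousOn P.Z P.dom := h4.tendsto_Z.continuousOn
    (D.eventually_mesh_mem.mono fun h hh => h4.continuous_Zh h hh).frequently
  refine tendsto_comp_of_locally_uniform_limit_within (F := fun k => D.Zh (h k)) (hc y hy)
    A.tendsto_pt_within fun u hu => ?_
  obtain ⟨t, ht, h1⟩ := h4.tendsto_Z u hu y hy
  exact ⟨t, ht, A.tendsto_mesh.eventually h1⟩

theorem hausdorffEDist_ne_top (s t : TopologicalSpace.NonemptyCompacts Y) :
    Metric.hausdorffEDist (s : Set Y) t ≠ ⊤ :=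
  Metric.hausdorffEDist_ne_top_of_nonempty_of_bounded s.nonempty t.nonempty
    s.isCompact.isBounded t.isCompact.isBounded

/-- Impulses `z k ∈ Z^h` converge, along an ultrafilter, to an impulse in the limit set. -/
theorem exists_tendsto_impulse (h4 : D.H4) {G : Ultrafilter κ} (A : D.Approx (G : Filter κ) h n i y)
    (hy : y ∈ P.dom) {z : κ → Y}
    (hz : ∀ᶠ k in (G : Filter κ), z k ∈ (D.Zh (h k) (D.pt (h k) (n k) (i k)) : Set Y)) :
    ∃ z₀ ∈ (P.Z y : Set Y), Tendsto z G (𝓝 z₀) := by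
  have h1 := tendsto_iff_dist_tendsto_zero.1 (tendsto_Zh h4 A hy)
  choose z' hz' hz'' using fun k => (P.Z y).isCompact.exists_infDist_eq_dist (P.Z y).nonempty (z k)
  obtain ⟨z₀, hz₀, hlim⟩ := exists_tendsto_of_isCompact (P.Z y).isCompact G (f := z')
    (.of_forall hz')
  refine ⟨z₀, hz₀, hlim.congr_dist ?_⟩
  refine squeeze_zero' (.of_forall fun _ => dist_nonneg) (hz.mono fun k hk => ?_) h1
  rw [dist_comm, ← hz'', Metric.NonemptyCompacts.dist_eq]
  exact Metric.infDist_le_hausdorffDist_of_mem hk (hausdorffEDist_ne_top _ _)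

/-- Every impulse in the limit set is a limit of impulses in `Z^h`. -/
theorem exists_impulse_tendsto (h4 : D.H4) {G : Filter κ} (A : D.Approx G h n i y)
    (hy : y ∈ P.dom) {z₀ : Y} (hz₀ : z₀ ∈ (P.Z y : Set Y)) :
    ∃ z : κ → Y, (∀ k, z k ∈ (D.Zh (h k) (D.pt (h k) (n k) (i k)) : Set Y)) ∧
      Tendsto z G (𝓝 z₀) := by
  have h1 := tendsto_iff_dist_tendsto_zero.1 (tendsto_Zh h4 A hy)
  choose z hz hz' using fun k => (D.Zh (h k) (D.pt (h k) (n k) (i k))).isCompact.exists_infDist_eq_dist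
    (D.Zh (h k) (D.pt (h k) (n k) (i k))).nonempty z₀
  refine ⟨z, hz, tendsto_iff_dist_tendsto_zero.2 ?_⟩
  refine squeeze_zero (fun _ => dist_nonneg) (fun k => ?_) h1
  rw [dist_comm, ← hz', dist_comm, Metric.NonemptyCompacts.dist_eq]
  exact Metric.infDist_le_hausdorffDist_of_mem hz₀ (hausdorffEDist_ne_top _ _)

theorem tendsto_impulse_data (h1 : P.H1) {G : Filter κ} (A : D.Approx G h n i y)
    (hy : y ∈ P.dom) {z : κ → Y} {z₀ : Y} (hz₀ : z₀ ∈ (P.Z y : Set Y)) (hlim : Tendsto z G (𝓝 z₀))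
    (hz : ∀ᶠ k in G, z k ∈ (D.Zh (h k) (D.pt (h k) (n k) (i k)) : Set Y)) :
    Tendsto (fun k => P.Γ (D.pt (h k) (n k) (i k)) (z k)) G (𝓝 (P.Γ y z₀)) ∧
      Tendsto (fun k => P.K (D.pt (h k) (n k) (i k)) (z k)) G (𝓝 (P.K y z₀)) := by
  have hmem : (y, z₀) ∈ P.impulseGraph := ⟨hy, hz₀⟩
  have h2 : Tendsto (fun k => (D.pt (h k) (n k) (i k), z k)) G (𝓝[P.impulseGraph] (y, z₀)) := by
    refine tendsto_nhdsWithin_iff.2 ⟨A.tendsto_pt.prodMk_nhds hlim, ?_⟩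
    filter_upwards [hz, A.eventually_mem, A.n_le] with k ha hb hc
    have := D.pt_mem_dom hb hc (i k)
    exact ⟨this, D.Zh_subset _ hb _ this ha⟩
  exact ⟨(h1.continuous_Γ _ hmem).tendsto.comp h2, (h1.continuous_K _ hmem).tendsto.comp h2⟩

theorem le_intervention_of_tendsto (h1 : P.H1) (h3 : P.H3) (h4 : D.H4) (hb : D.UniformBound v C)
    {G : Ultrafilter κ} (A : D.Approx (G : Filter κ) h n i y)
    (A' : D.Approx (G : Filter κ) h m i y) (hy : y ∈ P.dom) {r : κ → ℝ} {r₀ : ℝ}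
    (hr : Tendsto r G (𝓝 r₀)) (hle : ∀ᶠ k in (G : Filter κ),
      r k ≤ D.discreteIntervention (h k) (n k) (v (h k) (m k)) (i k)) :
    r₀ ≤ P.intervention (D.upper v) y := by
  have := D.neBot_mesh
  have hex : ∀ k, ∃ z, h k ∈ D.H → n k ≤ D.N (h k) →
      z ∈ (D.Zh (h k) (D.pt (h k) (n k) (i k)) : Set Y) ∧
      D.discreteIntervention (h k) (n k) (v (h k) (m k)) (i k)
        = D.interp (h k) (v (h k) (m k)) (P.Γ (D.pt (h k) (n k) (i k)) z)
          + P.K (D.pt (h k) (n k) (i k)) z := by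
    intro k
    by_cases hk : h k ∈ D.H ∧ n k ≤ D.N (h k)
    · obtain ⟨z, hz⟩ := exists_supOn_eq
        (D.Zh_finite _ hk.1 _ (D.pt_mem_dom hk.1 hk.2 (i k))) (D.Zh _ _).nonempty _
      exact ⟨z, fun _ _ => hz⟩
    · exact ⟨(P.Z y).nonempty.some, fun ha hb => absurd ⟨ha, hb⟩ hk⟩
  choose z hz using hex
  have hzm : ∀ᶠ k in (G : Filter κ), z k ∈ (D.Zh (h k) (D.pt (h k) (n k) (i k)) : Set Y) := by
    filter_upwards [A.eventually_mem, A.n_le] with k ha hb using (hz k ha hb).1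
  obtain ⟨z₀, hz₀, hlim⟩ := exists_tendsto_impulse h4 A hy hzm
  obtain ⟨hΓ, hK⟩ := tendsto_impulse_data h1 A hy hz₀ hlim hzm
  obtain ⟨j, j', α, B, B', hα⟩ := A'.exists_interp hΓ
  -- the interpolated value lies below one of the two nodal values
  let j₁ : κ → ℕ := fun k => if v (h k) (m k) (j k) ≤ v (h k) (m k) (j' k) then j' k else j k
  have B₁ : D.Approx (G : Filter κ) h m j₁ (y.1, P.Γ y z₀) := B'.ite _ B
  have h5 : r₀ - P.K y z₀ ≤ D.upper v (y.1, P.Γ y z₀) := by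
    refine le_upper_of_tendsto hb B₁ (hr.sub hK) ?_
    filter_upwards [hle, hα, A.eventually_mem, A.n_le] with k ha hb hc hd
    obtain ⟨h0, h1, -, -, -, hI⟩ := hb
    rw [(hz k hc hd).2, hI] at ha
    simp only [j₁]
    split_ifs with hif <;> nlinarith
  have h6 := P.le_intervention h3 (V := D.upper v)
    (fun y hy => (abs_le.1 (abs_upperLimit_le hb.extend hy)).2) hy hz₀
  linarith

theorem intervention_le_of_tendsto (h1 : P.H1) (h4 : D.H4) (hb : D.UniformBound v C)
    {G : Filter κ} [G.NeBot] (A : D.Approx G h n i y) (A' : D.Approx G h m i y) (hy : y ∈ P.dom)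
    {r : κ → ℝ} {r₀ : ℝ} (hr : Tendsto r G (𝓝 r₀)) (hle : ∀ᶠ k in G,
      D.discreteIntervention (h k) (n k) (v (h k) (m k)) (i k) ≤ r k) :
    P.intervention (D.lower v) y ≤ r₀ := by
  refine supOn_le (P.Z y).nonempty fun z₀ hz₀ => ?_
  obtain ⟨z, hz, hlim⟩ := exists_impulse_tendsto h4 A hy hz₀
  obtain ⟨hΓ, hK⟩ := tendsto_impulse_data h1 A hy hz₀ hlim (.of_forall hz)
  obtain ⟨j, j', α, B, B', hα⟩ := A'.exists_interp hΓ
  -- the interpolated value lies above one of the two nodal values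
  let j₁ : κ → ℕ := fun k => if v (h k) (m k) (j k) ≤ v (h k) (m k) (j' k) then j k else j' k
  have B₁ : D.Approx G h m j₁ (y.1, P.Γ y z₀) := B.ite _ B'
  have h5 : D.lower v (y.1, P.Γ y z₀) ≤ r₀ - P.K y z₀ := by
    refine lower_le_of_tendsto hb B₁ (hr.sub hK) ?_
    filter_upwards [hle, hα, A.eventually_mem, A.n_le] with k ha hb hc hd
    obtain ⟨h0, h1, -, -, -, hI⟩ := hb
    have h6 : D.interp (h k) (v (h k) (m k)) (P.Γ (D.pt (h k) (n k) (i k)) (z k))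
        + P.K (D.pt (h k) (n k) (i k)) (z k)
          ≤ D.discreteIntervention (h k) (n k) (v (h k) (m k)) (i k) :=
      le_supOn (D.Zh_finite _ hc _ (D.pt_mem_dom hc hd (i k))) (fun z =>
        D.interp (h k) (v (h k) (m k)) (P.Γ (D.pt (h k) (n k) (i k)) z)
          + P.K (D.pt (h k) (n k) (i k)) z) (hz k)
    rw [hI] at h6
    simp only [j₁]
    split_ifs with hif <;> nlinarith
  linarith

end Intervention

/-! ### Convergence of stable and consistent families -/

/-- The properties of a family of grid functions from which convergence follows: stability, the
terminal condition, and consistency with the two differential inequalities at times `τ^n < T`,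
tested on the limits of grid points where the family touches a smooth function. Monotonicity of the
scheme is built into the last two. -/
structure IsConsistent (D : Discretization P) (v : ℝ → ℕ → ℕ → ℝ) : Prop where
  bounded : ∃ C, D.UniformBound v C
  terminal : ∀ h ∈ D.H, ∀ i ≤ D.M h, v h 0 i = P.g (D.node h i)
  sub : ∀ {κ : Type} {G : Ultrafilter κ} {h : κ → ℝ} {n i : κ → ℕ} {y : ℝ × ℝ} {ψ : ℝ × ℝ → ℝ}
    {r : ℝ}, y ∈ P.dom → ContDiff ℝ 2 ψ → D.TouchesAbove v ψ G h n i y r →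
    (∀ᶠ k in (G : Filter κ), 1 ≤ n k) → r ≤ P.intervention (D.upper v) y ∨
      ∃ w, 0 ≤ deriv (fun s => ψ (s, y.2)) y.1 +
        P.ham y w (deriv (fun x => ψ (y.1, x)) y.2) (iteratedDeriv 2 (fun x => ψ (y.1, x)) y.2)
  super : ∀ {κ : Type} {G : Ultrafilter κ} {h : κ → ℝ} {n i : κ → ℕ} {y : ℝ × ℝ} {ψ : ℝ × ℝ → ℝ}
    {r : ℝ}, y ∈ P.dom → ContDiff ℝ 2 ψ → D.TouchesBelow v ψ G h n i y r →
    (∀ᶠ k in (G : Filter κ), 1 ≤ n k) → P.intervention (D.lower v) y ≤ r ∧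
      ∀ w, deriv (fun s => ψ (s, y.2)) y.1 +
        P.ham y w (deriv (fun x => ψ (y.1, x)) y.2) (iteratedDeriv 2 (fun x => ψ (y.1, x)) y.2) ≤ 0

namespace IsConsistent

theorem terminal_limit (h1 : P.H1) (hv : D.IsConsistent v) {κ : Type*} {G : Filter κ} [G.NeBot]
    {h : κ → ℝ} {n i : κ → ℕ} {y : ℝ × ℝ} (A : D.Approx G h n i y) (hn : ∀ᶠ k in G, n k = 0) :
    y.1 = P.T ∧ Tendsto (fun k => v (h k) (n k) (i k)) G (𝓝 (P.g y.2)) := by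
  refine ⟨tendsto_nhds_unique A.tendsto_time (tendsto_const_nhds.congr' (hn.mono fun k hk => ?_)),
    ((h1.continuous_g.tendsto _).comp A.tendsto_node).congr' ?_⟩
  · simp only [hk, D.time_zero]
  · filter_upwards [hn, A.eventually_mem, A.i_le] with k ha hb hc
    rw [ha, hv.terminal _ hb _ hc, Function.comp_apply]

theorem lower_le_terminal (h1 : P.H1) (hv : D.IsConsistent v) (x : ℝ) :
    D.lower v (P.T, x) ≤ P.g x := by
  have := D.neBot_mesh
  obtain ⟨C, hb⟩ := hv.bounded
  have hT : (P.T, x) ∈ P.dom := ⟨⟨P.T_pos.le, le_rfl⟩, mem_univ _⟩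
  have A := approx_nearest (D := D) (tendsto_id (x := 𝓝[D.H] (0 : ℝ)))
    (tendsto_nhdsWithin_iff.2 ⟨tendsto_const_nhds, .of_forall fun _ => hT⟩)
  have A₀ : D.Approx (𝓝[D.H] (0 : ℝ)) id (fun _ => 0) (fun h => D.nodeIndex h (P.T, x)) (P.T, x) := by
    refine ⟨A.tendsto_mesh, .of_forall fun _ => Nat.zero_le _, A.i_le, ?_⟩
    refine Tendsto.prodMk_nhds ?_ A.tendsto_node
    simp only [D.time_zero]
    exact tendsto_const_nhds
  exact lower_le_of_tendsto hb A₀ (hv.terminal_limit h1 A₀ (.of_forall fun _ => rfl)).2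
    (.of_forall fun _ => le_rfl)

variable [CompactSpace W] [Nonempty W]

theorem isSubsolution_upper (h1 : P.H1) (hv : D.IsConsistent v) :
    P.IsSubsolution (D.upper v) := by
  have := D.neBot_mesh
  obtain ⟨C, hb⟩ := hv.bounded
  refine ⟨upperSemicontinuousOn_upperLimit hb.extend, fun φ hφ y hy hmax => ?_⟩
  obtain ⟨ψ, hψ, hjet, G, h, n, i, ht⟩ := exists_touchesAbove hb hφ hy hmax
  rw [← hjet]
  refine Problem.Flower_nonpos h1 hy ?_
  rcases Ultrafilter.eventually_or.1 (Eventually.of_forall (f := (G : Filter (ℝ × (ℝ × ℝ))))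
    fun k => Nat.eq_zero_or_pos (n k)) with h0 | h0
  · obtain ⟨hT, hlim⟩ := hv.terminal_limit h1 ht.approx h0
    exact .inr (.inr ⟨hT, (tendsto_nhds_unique ht.tendsto_val hlim).le⟩)
  · rcases hv.sub hy hψ ht h0 with h2 | h2
    · exact .inl h2
    · exact .inr (.inl h2)

theorem isSupersolution_lower (h1 : P.H1) (h3 : P.H3) (hv : D.IsConsistent v) :
    P.IsSupersolution (D.lower v) := by
  have := D.neBot_mesh
  obtain ⟨C, hb⟩ := hv.bounded
  refine ⟨lowerSemicontinuousOn_lowerLimit hb.extend, fun φ hφ y hy hmin => ?_⟩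
  obtain ⟨ψ, hψ, hjet, G, h, n, i, ht⟩ := exists_touchesBelow hb hφ hy hmin
  rw [← hjet]
  rcases Ultrafilter.eventually_or.1 (Eventually.of_forall (f := (G : Filter (ℝ × (ℝ × ℝ))))
    fun k => Nat.eq_zero_or_pos (n k)) with h0 | h0
  · obtain ⟨hT, hlim⟩ := hv.terminal_limit h1 ht.approx h0
    have hval : D.lower v y = P.g y.2 := by
      have := tendsto_nhds_unique ht.tendsto_val hlim.neg
      linarith
    refine Problem.Fupper_nonneg h1 hy ?_ (.inr ⟨hT, hval.ge⟩)
    obtain ⟨B, hB⟩ := h1.bounded_g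
    have hyT : y = (P.T, y.2) := Prod.ext hT rfl
    -- an impulse at the terminal time cannot improve on `g`
    refine le_trans ?_ ((h1.suboptimal y.2).trans hval.ge)
    rw [← hyT]
    refine supOn_le (P.Z y).nonempty fun z hz => ?_
    refine le_trans ?_ (Problem.le_intervention h3 (V := fun y => P.g y.2)
      (fun y _ => (abs_le.1 (hB y.2)).2) hy hz)
    have := hv.lower_le_terminal h1 (P.Γ y z)
    simp only [hT]
    linarith
  · obtain ⟨h2, h5⟩ := hv.super hy hψ ht h0
    exact Problem.Fupper_nonneg h1 hy h2 (.inl h5)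

/-- Under comparison, the half-relaxed limits of a consistent family coincide and are a bounded
solution, to which the family converges. -/
theorem convergesTo_upper (h1 : P.H1) (h3 : P.H3) (hcomp : P.Comparison) (hv : D.IsConsistent v) :
    P.IsBdd (D.upper v) ∧ P.IsSolution (D.upper v) ∧ D.ConvergesTo v (D.upper v) := by
  have := D.neBot_mesh
  obtain ⟨C, hb⟩ := hv.bounded
  have hU : P.IsBdd (D.upper v) := ⟨C, fun y hy => abs_upperLimit_le hb.extend hy⟩
  have hL : P.IsBdd (D.lower v) := ⟨C, fun y hy => abs_lowerLimit_le hb.extend hy⟩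
  have hsub := hv.isSubsolution_upper h1
  have hsup := hv.isSupersolution_lower h1 h3
  have heq : EqOn (D.lower v) (D.upper v) P.dom := fun y hy =>
    le_antisymm (lowerLimit_le_upperLimit hb.extend hy) (hcomp _ _ hU hL hsub hsup y hy)
  exact ⟨hU, ⟨hsub, hsup.congr heq⟩,
    tendstoLocallyUniformlyOn_of_relaxedLimits hb.extend (fun _ _ => rfl) heq⟩

end IsConsistent

end Discretization

end HJBQVI

namespace HJBQVI

namespace Discretization

variable {W Y : Type*} [MetricSpace Y] {P : Problem W Y} {D : Discretization P}

/-! ### Monotonicity of the difference operators -/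

theorem D2_le {h : ℝ} (hh : h ∈ D.H) {U X : ℕ → ℝ} {i : ℕ}
    (hp : 0 < i → i < D.M h → U (i + 1) - X (i + 1) ≤ U i - X i)
    (hm : 0 < i → i < D.M h → U (i - 1) - X (i - 1) ≤ U i - X i) : D.D2 h U i ≤ D.D2 h X i := by
  have h1 := D.dx_pos hh
  rw [D2, D2]
  split_ifs with h2
  · have := hp h2.1 h2.2
    have := hm h2.1 h2.2
    gcongr ?_ / _
    linarith
  · exact le_rfl

theorem upwind_le {h : ℝ} (hh : h ∈ D.H) (α : ℝ) {U X : ℕ → ℝ} {i : ℕ}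
    (hp : 0 < i → i < D.M h → U (i + 1) - X (i + 1) ≤ U i - X i)
    (hm : 0 < i → i < D.M h → U (i - 1) - X (i - 1) ≤ U i - X i) :
    D.upwind h α U i ≤ D.upwind h α X i := by
  have h1 := D.dx_pos hh
  rw [upwind, upwind]
  split_ifs with hα
  · refine mul_le_mul_of_nonneg_left ?_ hα.le
    rw [Dplus, Dplus]
    split_ifs with h2
    · have := hp h2.1 h2.2
      gcongr ?_ / _
      linarith
    · exact le_rfl
  · refine mul_le_mul_of_nonpos_left ?_ (not_lt.1 hα)
    rw [Dminus, Dminus]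
    split_ifs with h2
    · have := hm h2.1 h2.2
      gcongr ?_ / _
      linarith
    · exact le_rfl

theorem D2_const (h c : ℝ) (i : ℕ) : D.D2 h (fun _ => c) i = 0 := by
  rw [D2]; split_ifs <;> ring

theorem upwind_const (h α c : ℝ) (i : ℕ) : D.upwind h α (fun _ => c) i = 0 := by
  simp [upwind, Dplus, Dminus]

theorem gam_le {h : ℝ} (hh : h ∈ D.H) {u x : ℕ → ℕ → ℝ} {n i : ℕ} (w : W)
    (ht : u (n - 1) i - x (n - 1) i ≤ u n i - x n i)
    (hp : 0 < i → i < D.M h → u n (i + 1) - x n (i + 1) ≤ u n i - x n i)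
    (hm : 0 < i → i < D.M h → u n (i - 1) - x n (i - 1) ≤ u n i - x n i) :
    D.gam h u n i w ≤ D.gam h x n i w := by
  have h1 := D.dt_pos hh
  have h2 := D2_le hh hp hm
  have h3 := upwind_le hh (P.a (D.pt h n i) w) hp hm
  have h4 : (u (n - 1) i - u n i) / D.dt h ≤ (x (n - 1) i - x n i) / D.dt h := by
    gcongr ?_ / _
    linarith
  rw [gam, gam]
  gcongr

/-! ### Consistency of the difference operators -/

section Consistency

variable {κ : Type*} {h : κ → ℝ} {n i : κ → ℕ} {y : ℝ × ℝ} {ψ : ℝ × ℝ → ℝ}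

theorem tendsto_D2 {G : Filter κ} (A : D.Approx G h n i y) (hψ : ContDiff ℝ 2 ψ) :
    Tendsto (fun k => D.D2 (h k) (fun i => ψ (D.pt (h k) (n k) i)) (i k)) G
      (𝓝 (iteratedDeriv 2 (fun x => ψ (y.1, x)) y.2)) := by
  refine (tendsto_secondDifference hψ A.tendsto_pt A.tendsto_dx
    (A.eventually_mem.mono fun k hk => D.dx_pos hk)).congr' ?_
  filter_upwards [A.eventually_interior] with k hk
  rw [D2, if_pos hk]
  simp only [pt, node_add_one, D.node_sub_one _ hk.1]

theorem tendsto_upwind {G : Filter κ} (A : D.Approx G h n i y) (hψ : ContDiff ℝ 2 ψ)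
    {α : κ → ℝ} {α₀ : ℝ} (hα : Tendsto α G (𝓝 α₀)) :
    Tendsto (fun k => D.upwind (h k) (α k) (fun i => ψ (D.pt (h k) (n k) i)) (i k)) G
      (𝓝 (α₀ * deriv (fun x => ψ (y.1, x)) y.2)) := by
  rw [deriv_snd_eq (hψ.differentiable (by norm_num)) y]
  have hdx : ∀ᶠ k in G, D.dx (h k) ≠ 0 := A.eventually_mem.mono fun k hk => (D.dx_pos hk).ne'
  have hplus : Tendsto (fun k => D.Dplus (h k) (fun i => ψ (D.pt (h k) (n k) i)) (i k)) G
      (𝓝 (fderiv ℝ ψ y (0, 1))) := by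
    refine (tendsto_firstDifference (e := fun _ => (0, 1)) hψ A.tendsto_pt A.tendsto_dx hdx
      tendsto_const_nhds).congr' ?_
    filter_upwards [A.eventually_interior] with k hk
    rw [Dplus, if_pos hk]
    simp [pt, node_add_one]
  have hminus : Tendsto (fun k => D.Dminus (h k) (fun i => ψ (D.pt (h k) (n k) i)) (i k)) G
      (𝓝 (fderiv ℝ ψ y (0, 1))) := by
    have hd : Tendsto (fun k => -D.dx (h k)) G (𝓝 0) := by simpa using A.tendsto_dx.neg
    refine (tendsto_firstDifference (e := fun _ => (0, 1)) hψ A.tendsto_pt hd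
      (hdx.mono fun k hk => neg_ne_zero.2 hk) tendsto_const_nhds).congr' ?_
    filter_upwards [A.eventually_interior] with k hk
    rw [Dminus, if_pos hk, div_neg, ← neg_div, neg_sub]
    simp [pt, D.node_sub_one _ hk.1, sub_eq_add_neg]
  exact Tendsto.if' (hα.mul hplus) (hα.mul hminus)

variable [MetricSpace W]

theorem tendsto_coefficient {G : Filter κ} (A : D.Approx G h n i y) (hy : y ∈ P.dom)
    {c : ℝ × ℝ → W → ℝ} (hc : ContinuousOn (fun q : (ℝ × ℝ) × W => c q.1 q.2) (P.dom ×ˢ univ))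
    {w : κ → W} {w₀ : W} (hw : Tendsto w G (𝓝 w₀)) :
    Tendsto (fun k => c (D.pt (h k) (n k) (i k)) (w k)) G (𝓝 (c y w₀)) := by
  have h2 : Tendsto (fun k => (D.pt (h k) (n k) (i k), w k)) G (𝓝[P.dom ×ˢ univ] (y, w₀)) := by
    refine tendsto_nhdsWithin_iff.2 ⟨A.tendsto_pt.prodMk_nhds hw, ?_⟩
    filter_upwards [A.eventually_mem, A.n_le] with k hb hc'
    exact ⟨D.pt_mem_dom hb hc' (i k), mem_univ _⟩
  exact Tendsto.comp (hc (y, w₀) ⟨hy, mem_univ _⟩) h2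

theorem tendsto_gam (h1 : P.H1) {G : Filter κ} (A : D.Approx G h n i y) (hy : y ∈ P.dom)
    (hn : ∀ᶠ k in G, 1 ≤ n k) (hψ : ContDiff ℝ 2 ψ) {w : κ → W} {w₀ : W}
    (hw : Tendsto w G (𝓝 w₀)) :
    Tendsto (fun k => D.gam (h k) (fun n i => ψ (D.pt (h k) n i)) (n k) (i k) (w k)) G
      (𝓝 (deriv (fun s => ψ (s, y.2)) y.1 +
        P.ham y w₀ (deriv (fun x => ψ (y.1, x)) y.2) (iteratedDeriv 2 (fun x => ψ (y.1, x)) y.2))) := by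
  have ht : Tendsto (fun k => (ψ (D.pt (h k) (n k - 1) (i k)) - ψ (D.pt (h k) (n k) (i k)))
      / D.dt (h k)) G (𝓝 (deriv (fun s => ψ (s, y.2)) y.1)) := by
    rw [deriv_fst_eq (hψ.differentiable (by norm_num)) y]
    refine (tendsto_firstDifference (e := fun _ => (1, 0)) hψ A.tendsto_pt A.tendsto_dt
      (A.eventually_mem.mono fun k hk => (D.dt_pos hk).ne') tendsto_const_nhds).congr' ?_
    filter_upwards [hn] with k hk
    simp [pt, D.time_pred _ hk]
  have hb := tendsto_coefficient A hy h1.continuous_b hw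
  have ha := tendsto_upwind A hψ (tendsto_coefficient A hy h1.continuous_a hw)
  have hf := tendsto_coefficient A hy h1.continuous_f hw
  have := ((ht.add (((hb.pow 2).const_mul (1 / 2)).mul (tendsto_D2 A hψ))).add ha).add hf
  simpa only [gam, Problem.ham, add_assoc] using this

variable {v : ℝ → ℕ → ℕ → ℝ} {r : ℝ}

omit [MetricSpace W] in
theorem TouchesAbove.eventually_gam_le {G : Ultrafilter κ} (ht : D.TouchesAbove v ψ G h n i y r)
    (hn : ∀ᶠ k in (G : Filter κ), 1 ≤ n k) : ∀ᶠ k in (G : Filter κ), ∀ w,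
      D.gam (h k) (v (h k)) (n k) (i k) w
        ≤ D.gam (h k) (fun n i => ψ (D.pt (h k) n i)) (n k) (i k) w := by
  filter_upwards [ht.approx.eventually_mem, ht.max _ _ (ht.approx.pred_time hn),
    ht.max _ _ ht.approx.add_one, ht.max _ _ ht.approx.sub_one] with k hk h2 h3 h4 w
  exact gam_le hk w h2 (fun _ _ => h3) (fun _ _ => h4)

omit [MetricSpace W] in
theorem TouchesBelow.eventually_le_gam {G : Ultrafilter κ} (ht : D.TouchesBelow v ψ G h n i y r)
    (hn : ∀ᶠ k in (G : Filter κ), 1 ≤ n k) : ∀ᶠ k in (G : Filter κ), ∀ w,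
      D.gam (h k) (fun n i => ψ (D.pt (h k) n i)) (n k) (i k) w
        ≤ D.gam (h k) (v (h k)) (n k) (i k) w := by
  have A := ht.approx
  filter_upwards [A.eventually_mem, ht.max _ _ (A.pred_time hn),
    ht.max _ _ A.add_one, ht.max _ _ A.sub_one] with k hk h2 h3 h4 w
  exact gam_le hk w (by linarith) (fun _ _ => by linarith) (fun _ _ => by linarith)

omit [MetricSpace W] in
theorem TouchesAbove.eventually_D2_le {G : Ultrafilter κ} (ht : D.TouchesAbove v ψ G h n i y r) :
    ∀ᶠ k in (G : Filter κ), D.D2 (h k) (v (h k) (n k)) (i k)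
      ≤ D.D2 (h k) (fun i => ψ (D.pt (h k) (n k) i)) (i k) := by
  filter_upwards [ht.approx.eventually_mem, ht.max _ _ ht.approx.add_one,
    ht.max _ _ ht.approx.sub_one] with k hk h3 h4
  exact D2_le hk (fun _ _ => h3) (fun _ _ => h4)

omit [MetricSpace W] in
theorem TouchesBelow.eventually_le_D2 {G : Ultrafilter κ} (ht : D.TouchesBelow v ψ G h n i y r) :
    ∀ᶠ k in (G : Filter κ), D.D2 (h k) (fun i => ψ (D.pt (h k) (n k) i)) (i k)
      ≤ D.D2 (h k) (v (h k) (n k)) (i k) := by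
  have A := ht.approx
  filter_upwards [A.eventually_mem, ht.max _ _ A.add_one, ht.max _ _ A.sub_one] with k hk h3 h4
  exact D2_le hk (fun _ _ => by linarith) (fun _ _ => by linarith)

omit [MetricSpace W] in
/-- The semi-Lagrangian difference quotient along the characteristic through the touching point is
dominated by quantities converging to `ψ_t + α₀ ψ_x`. -/
theorem TouchesAbove.exists_semiLagrangian_le {G : Ultrafilter κ}
    (ht : D.TouchesAbove v ψ G h n i y r) (hn : ∀ᶠ k in (G : Filter κ), 1 ≤ n k)
    (hψ : ContDiff ℝ 2 ψ) {α : κ → ℝ} {α₀ : ℝ} (hα : Tendsto α G (𝓝 α₀)) :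
    ∃ q : κ → ℝ, Tendsto q G (𝓝 (deriv (fun s => ψ (s, y.2)) y.1
        + α₀ * deriv (fun x => ψ (y.1, x)) y.2)) ∧ ∀ᶠ k in (G : Filter κ),
      (D.interp (h k) (v (h k) (n k - 1)) (D.node (h k) (i k) + α k * D.dt (h k))
        - v (h k) (n k) (i k)) / D.dt (h k) ≤ q k := by
  have A := ht.approx
  have hx : Tendsto (fun k => D.node (h k) (i k) + α k * D.dt (h k)) G (𝓝 y.2) := by
    simpa using A.tendsto_node.add (hα.mul A.tendsto_dt)
  obtain ⟨j, j', β, B, B', hβ⟩ := (A.pred_time hn).exists_interp hx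
  obtain ⟨β₀, -, hβ₀⟩ := exists_tendsto_of_isCompact (isCompact_Icc (a := (0 : ℝ)) (b := 1)) G
    (f := β) (hβ.mono fun k hk => ⟨hk.1, hk.2.1⟩)
  -- the slopes from `(τ^n, x_i)` to the two nodes used by the interpolation are bounded, as `Δx / Δτ`
  -- is constant, so they converge along the ultrafilter
  have hslope : ∀ m : κ → ℕ, (∀ᶠ k in (G : Filter κ), |D.node (h k) (m k)
      - (D.node (h k) (i k) + α k * D.dt (h k))| ≤ D.dx (h k)) →
      ∃ s₀, Tendsto (fun k => (D.node (h k) (m k) - D.node (h k) (i k)) / D.dt (h k)) G (𝓝 s₀) := by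
    intro m hm
    obtain ⟨s₀, -, hs₀⟩ := exists_tendsto_of_isCompact
      (isCompact_Icc (a := α₀ - 1 - D.cx / D.cτ) (b := α₀ + 1 + D.cx / D.cτ)) G
      (f := fun k => (D.node (h k) (m k) - D.node (h k) (i k)) / D.dt (h k)) (by
        filter_upwards [hm, A.eventually_mem, hα.eventually (lt_mem_nhds (sub_one_lt α₀)),
          hα.eventually (gt_mem_nhds (lt_add_one α₀))] with k h1 h2 h3 h4
        have h5 := D.dt_pos h2
        have h6 : D.dx (h k) = D.cx / D.cτ * D.dt (h k) := by
          have h7 : D.dt (h k) = D.cτ * h k := D.step_eq _ h2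
          have := D.cτ_pos.ne'
          rw [h7, dx]; field_simp
        rw [h6] at h1
        obtain ⟨h8, h9⟩ := abs_le.1 h1
        constructor
        · rw [le_div_iff₀ h5]; nlinarith
        · rw [div_le_iff₀ h5]; nlinarith)
    exact ⟨s₀, hs₀⟩
  obtain ⟨s₀, hs⟩ := hslope j (hβ.mono fun k hk => hk.2.2.2.1)
  obtain ⟨s₀', hs'⟩ := hslope j' (hβ.mono fun k hk => hk.2.2.2.2.1)
  have hdt : ∀ᶠ k in (G : Filter κ), D.dt (h k) ≠ 0 :=
    A.eventually_mem.mono fun k hk => (D.dt_pos hk).ne'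
  have hquot : ∀ (m : κ → ℕ) (s : ℝ),
      Tendsto (fun k => (D.node (h k) (m k) - D.node (h k) (i k)) / D.dt (h k)) G (𝓝 s) →
      Tendsto (fun k => (ψ (D.pt (h k) (n k - 1) (m k)) - ψ (D.pt (h k) (n k) (i k))) / D.dt (h k))
        G (𝓝 (fderiv ℝ ψ y (1, s))) := by
    intro m s hm
    refine (tendsto_firstDifference hψ A.tendsto_pt A.tendsto_dt hdt
      (tendsto_const_nhds.prodMk_nhds hm (x := 1))).congr' ?_
    filter_upwards [hn, hdt] with k h1 h2
    have h3 : D.pt (h k) (n k) (i k) + D.dt (h k) •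
        ((1 : ℝ), (D.node (h k) (m k) - D.node (h k) (i k)) / D.dt (h k))
        = D.pt (h k) (n k - 1) (m k) := by
      refine Prod.ext ?_ ?_
      · simp [pt, D.time_pred _ h1]
      · simp only [pt, Prod.smul_mk, Prod.mk_add_mk, smul_eq_mul]; field_simp; ring
    rw [h3]
  have hsum : β₀ * s₀' + (1 - β₀) * s₀ = α₀ := by
    refine tendsto_nhds_unique ((hβ₀.mul hs').add ((tendsto_const_nhds.sub hβ₀).mul hs)) ?_
    refine hα.congr' ?_
    filter_upwards [hβ, hdt] with k hk h2
    have := hk.2.2.1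
    field_simp
    linarith
  have hlim := (hβ₀.mul (hquot j' s₀' hs')).add
    (((tendsto_const_nhds (x := (1 : ℝ))).sub hβ₀).mul (hquot j s₀ hs))
  have hval : β₀ * fderiv ℝ ψ y (1, s₀') + (1 - β₀) * fderiv ℝ ψ y (1, s₀)
      = deriv (fun s => ψ (s, y.2)) y.1 + α₀ * deriv (fun x => ψ (y.1, x)) y.2 := by
    have hd := hψ.differentiable (by norm_num)
    rw [deriv_fst_eq hd, deriv_snd_eq hd]
    have hlin : ∀ s : ℝ, fderiv ℝ ψ y (1, s) = fderiv ℝ ψ y (1, 0) + s * fderiv ℝ ψ y (0, 1) := by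
      intro s
      rw [← smul_eq_mul, ← map_smul, ← map_add]; simp
    rw [hlin s₀, hlin s₀', ← hsum]; ring
  rw [hval] at hlim
  refine ⟨_, hlim, ?_⟩
  filter_upwards [hβ, ht.max _ _ B, ht.max _ _ B', A.eventually_mem] with k hk h2 h3 h4
  obtain ⟨h5, h6, -, -, -, h7⟩ := hk
  have h8 := D.dt_pos h4
  rw [h7, mul_div_assoc', mul_div_assoc', ← add_div]
  gcongr ?_ / _
  nlinarith

omit [MetricSpace W] in
theorem interp_neg {h : ℝ} (hh : h ∈ D.H) (U : ℕ → ℝ) (x : ℝ) :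
    D.interp h (fun i => -U i) x = -D.interp h U x := by
  obtain ⟨j, j', α, -, -, -, -, he, -⟩ := D.exists_interp_eq hh x
  rw [he, he]; ring

omit [MetricSpace W] in
theorem TouchesBelow.exists_le_semiLagrangian {G : Ultrafilter κ}
    (ht : D.TouchesBelow v ψ G h n i y r) (hn : ∀ᶠ k in (G : Filter κ), 1 ≤ n k)
    (hψ : ContDiff ℝ 2 ψ) {α : κ → ℝ} {α₀ : ℝ} (hα : Tendsto α G (𝓝 α₀)) :
    ∃ q : κ → ℝ, Tendsto q G (𝓝 (deriv (fun s => ψ (s, y.2)) y.1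
        + α₀ * deriv (fun x => ψ (y.1, x)) y.2)) ∧ ∀ᶠ k in (G : Filter κ), q k ≤
      (D.interp (h k) (v (h k) (n k - 1)) (D.node (h k) (i k) + α k * D.dt (h k))
        - v (h k) (n k) (i k)) / D.dt (h k) := by
  obtain ⟨q, hq, hle⟩ := TouchesAbove.exists_semiLagrangian_le ht hn hψ.neg hα
  refine ⟨fun k => -q k, ?_, ?_⟩
  · convert hq.neg using 2
    simp only [deriv.fun_neg]; ring
  · filter_upwards [hle, ht.approx.eventually_mem] with k hk h2
    rw [interp_neg h2, sub_neg_eq_add, neg_add_eq_sub, ← neg_sub, neg_div] at hk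
    linarith

end Consistency

end Discretization

end HJBQVI

namespace HJBQVI

namespace Discretization

variable {W Y : Type*} [MetricSpace Y] {P : Problem W Y} {D : Discretization P}

/-! ### Controls -/

theorem controls_finite (h : ℝ) : (D.controls h).Finite :=
  (Set.toFinite _).prod (D.Wh h).finite_toSet

theorem controls_nonempty {h : ℝ} (hh : h ∈ D.H) : (D.controls h).Nonempty :=
  (insert_nonempty _ _).prod (D.Wh_nonempty h hh)

theorem exists_of_nonneg_supOn_controls {h : ℝ} (hh : h ∈ D.H) {f : ℝ × W → ℝ}
    (hf : 0 ≤ supOn (D.controls h) f) : ∃ w ∈ D.Wh h, 0 ≤ f (0, w) ∨ 0 ≤ f (1, w) := by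
  obtain ⟨⟨d, w⟩, ⟨hd, hw⟩, he⟩ := exists_supOn_eq (controls_finite h) (controls_nonempty hh) f
  rw [he] at hf
  rcases hd with hd | hd
  · simp only at hd; subst hd; exact ⟨w, hw, .inl hf⟩
  · simp only [mem_singleton_iff] at hd; subst hd; exact ⟨w, hw, .inr hf⟩

theorem forall_of_supOn_controls_nonpos {h : ℝ} {f : ℝ × W → ℝ}
    (hf : supOn (D.controls h) f ≤ 0) {w : W} (hw : w ∈ D.Wh h) : f (0, w) ≤ 0 ∧ f (1, w) ≤ 0 :=
  ⟨(le_supOn (controls_finite h) f ⟨.inl rfl, hw⟩).trans hf,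
    (le_supOn (controls_finite h) f ⟨.inr (mem_singleton _), hw⟩).trans hf⟩

theorem exists_control_tendsto [MetricSpace W] [CompactSpace W] (h4 : D.H4) {κ : Type*}
    {G : Filter κ} {h : κ → ℝ} (hh : Tendsto h G (𝓝[D.H] 0)) (w₀ : W) :
    ∃ w : κ → W, (∀ᶠ k in G, w k ∈ D.Wh (h k)) ∧ Tendsto w G (𝓝 w₀) := by
  have hex : ∀ k, ∃ w, h k ∈ D.H → w ∈ D.Wh (h k) ∧
      dist w w₀ ≤ Metric.hausdorffDist (D.Wh (h k) : Set W) univ := by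
    intro k
    by_cases hk : h k ∈ D.H
    · have hne : (D.Wh (h k) : Set W).Nonempty := D.Wh_nonempty _ hk
      obtain ⟨w, hw, hd⟩ :=
        (D.Wh (h k)).finite_toSet.isCompact.exists_infDist_eq_dist hne w₀
      refine ⟨w, fun _ => ⟨hw, ?_⟩⟩
      rw [dist_comm, ← hd, Metric.hausdorffDist_comm]
      exact Metric.infDist_le_hausdorffDist_of_mem (mem_univ _)
        (Metric.hausdorffEDist_ne_top_of_nonempty_of_bounded ⟨w₀, mem_univ _⟩ hne
          isCompact_univ.isBounded (D.Wh (h k)).finite_toSet.isCompact.isBounded)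
    · exact ⟨w₀, fun h => absurd h hk⟩
  choose w hw using hex
  have hm := hh.eventually D.eventually_mesh_mem
  exact ⟨w, hm.mono fun k hk => (hw k hk).1, tendsto_iff_dist_tendsto_zero.2
    (squeeze_zero' (.of_forall fun _ => dist_nonneg) (hm.mono fun k hk => (hw k hk).2)
      (h4.tendsto_W.comp hh))⟩

/-! ### Stability -/

theorem interp_le {h : ℝ} (hh : h ∈ D.H) {U : ℕ → ℝ} {B : ℝ} (hU : ∀ i ≤ D.M h, U i ≤ B) (x : ℝ) :
    D.interp h U x ≤ B :=
  (D.interp_mono hh hU x).trans_eq (D.interp_const hh B x)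

theorem le_interp {h : ℝ} (hh : h ∈ D.H) {U : ℕ → ℝ} {B : ℝ} (hU : ∀ i ≤ D.M h, B ≤ U i) (x : ℝ) :
    B ≤ D.interp h U x :=
  (D.interp_const hh B x).symm.trans_le (D.interp_mono hh hU x)

/-- Every impulse has a positive cost, so interventions stay strictly below a bound of the row. -/
theorem discreteIntervention_lt {h : ℝ} (h3 : P.H3) (hh : h ∈ D.H) {n : ℕ} (hn : n ≤ D.N h)
    {U : ℕ → ℝ} {B : ℝ} (hU : ∀ i ≤ D.M h, U i ≤ B) (i : ℕ) :
    D.discreteIntervention h n U i < B := by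
  obtain ⟨c, hc, hK⟩ := h3
  have hd := D.pt_mem_dom hh hn i
  refine (supOn_le (D.Zh _ _).nonempty fun z hz => ?_).trans_lt (show B + c < B by linarith)
  exact add_le_add (interp_le hh hU _) (hK (_, z) ⟨hd, D.Zh_subset h hh _ hd hz⟩)

theorem gam_max_le {h : ℝ} (hh : h ∈ D.H) {u : ℕ → ℕ → ℝ} {n i : ℕ}
    (hmax : ∀ j ≤ D.M h, u n j ≤ u n i) (w : W) :
    D.gam h u n i w ≤ (u (n - 1) i - u n i) / D.dt h + P.f (D.pt h n i) w := by
  have h2 := D2_le hh (U := u n) (X := fun _ => 0) (i := i)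
    (fun _ h => by simpa using hmax _ h) (fun _ _ => by simpa using hmax _ (by omega))
  have h3 := upwind_le hh (P.a (D.pt h n i) w) (U := u n) (X := fun _ => 0) (i := i)
    (fun _ h => by simpa using hmax _ h) (fun _ _ => by simpa using hmax _ (by omega))
  rw [D2_const] at h2
  rw [upwind_const] at h3
  have h5 : 1 / 2 * P.b (D.pt h n i) w ^ 2 * D.D2 h (u n) i ≤ 0 :=
    mul_nonpos_of_nonneg_of_nonpos (by positivity) h2
  rw [gam]
  linarith

theorem le_gam_min {h : ℝ} (hh : h ∈ D.H) {u : ℕ → ℕ → ℝ} {n i : ℕ}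
    (hmin : ∀ j ≤ D.M h, u n i ≤ u n j) (w : W) :
    (u (n - 1) i - u n i) / D.dt h + P.f (D.pt h n i) w ≤ D.gam h u n i w := by
  have h2 := D2_le hh (X := u n) (U := fun _ => 0) (i := i)
    (fun _ h => by simpa using hmin _ h) (fun _ _ => by simpa using hmin _ (by omega))
  have h3 := upwind_le hh (P.a (D.pt h n i) w) (X := u n) (U := fun _ => 0) (i := i)
    (fun _ h => by simpa using hmin _ h) (fun _ _ => by simpa using hmin _ (by omega))
  rw [D2_const] at h2
  rw [upwind_const] at h3
  have h5 : 0 ≤ 1 / 2 * P.b (D.pt h n i) w ^ 2 * D.D2 h (u n) i := by positivity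
  rw [gam]
  linarith

/-- One-step growth bounds give a uniform bound, by induction on the time level. -/
theorem uniformBound_of_step {v : ℝ → ℕ → ℕ → ℝ} {Cg Cf : ℝ} (hCf : 0 ≤ Cf)
    (h0 : ∀ h ∈ D.H, ∀ i ≤ D.M h, |v h 0 i| ≤ Cg)
    (hup : ∀ h ∈ D.H, ∀ n, 1 ≤ n → n ≤ D.N h → ∀ B, (∀ i ≤ D.M h, v h (n - 1) i ≤ B) →
      ∀ i ≤ D.M h, v h n i ≤ B + D.dt h * Cf)
    (hlo : ∀ h ∈ D.H, ∀ n, 1 ≤ n → n ≤ D.N h → ∀ B, (∀ i ≤ D.M h, B ≤ v h (n - 1) i) →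
      ∀ i ≤ D.M h, B - D.dt h * Cf ≤ v h n i) :
    D.UniformBound v (Cg + P.T * Cf) := by
  intro h hh
  have hdt := D.dt_pos hh
  have key : ∀ n ≤ D.N h, ∀ i ≤ D.M h, |v h n i| ≤ Cg + n * D.dt h * Cf := by
    intro n
    induction n with
    | zero => intro _ i hi; simpa using h0 h hh i hi
    | succ n ih =>
      intro hn i hi
      have ih' := ih (by omega)
      have h1 := hup h hh (n + 1) (by omega) hn (Cg + n * D.dt h * Cf)
        (fun i hi => (abs_le.1 (ih' i hi)).2) i hi
      have h2 := hlo h hh (n + 1) (by omega) hn (-(Cg + n * D.dt h * Cf))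
        (fun i hi => (abs_le.1 (ih' i hi)).1) i hi
      rw [abs_le]
      push_cast
      constructor <;> linarith
  intro n hn i hi
  refine (key n hn i hi).trans ?_
  have : (n : ℝ) * D.dt h ≤ P.T := by rw [← D.N_mul_dt hh]; gcongr
  gcongr

theorem exists_max_row (h : ℝ) (U : ℕ → ℝ) : ∃ i ≤ D.M h, ∀ j ≤ D.M h, U j ≤ U i := by
  obtain ⟨i, hi, hmax⟩ := (finite_Iic (D.M h)).exists_maximalFor U _ ⟨0, Nat.zero_le _⟩
  exact ⟨i, hi, fun j hj => (le_total (U j) (U i)).elim id fun h => hmax hj h⟩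

theorem exists_min_row (h : ℝ) (U : ℕ → ℝ) : ∃ i ≤ D.M h, ∀ j ≤ D.M h, U i ≤ U j := by
  obtain ⟨i, hi, hmin⟩ := exists_max_row (D := D) h fun i => -U i
  exact ⟨i, hi, fun j hj => neg_le_neg_iff.1 (hmin j hj)⟩

/-! ### The direct control and penalty schemes -/

/-- The direct control scheme is the penalty scheme with penalty parameter zero. -/
theorem penaltyS_zero (h : ℝ) (n i : ℕ) (u : ℕ → ℕ → ℝ) (ℓ : ℝ) :
    D.penaltyS 0 h n i u ℓ = D.directS h n i u ℓ := by
  simp only [penaltyS, directS, zero_mul, add_zero]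

/-- The supremum over the controls in the penalty scheme. -/
noncomputable def penaltySup (D : Discretization P) (ε h : ℝ) (n i : ℕ) (u : ℕ → ℕ → ℝ) : ℝ :=
  supOn (D.controls h) fun c => (1 - c.1) * D.gam h u n i c.2
    + c.1 * (D.discreteIntervention h n (u n) i - u n i + ε * D.gam h u n i c.2)

theorem penaltySup_sub {ε h : ℝ} (hh : h ∈ D.H) {n i : ℕ} {u : ℕ → ℕ → ℝ}
    (hu : 0 ≤ D.penaltySup ε h n i u) : ∃ w ∈ D.Wh h, 0 ≤ D.gam h u n i w ∨
      0 ≤ D.discreteIntervention h n (u n) i - u n i + ε * D.gam h u n i w := by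
  obtain ⟨w, hw, h1⟩ := exists_of_nonneg_supOn_controls hh hu
  exact ⟨w, hw, by simpa using h1⟩

theorem penaltySup_super {ε h : ℝ} {n i : ℕ} {u : ℕ → ℕ → ℝ}
    (hu : D.penaltySup ε h n i u ≤ 0) {w : W} (hw : w ∈ D.Wh h) : D.gam h u n i w ≤ 0 ∧
      D.discreteIntervention h n (u n) i - u n i + ε * D.gam h u n i w ≤ 0 := by
  simpa using forall_of_supOn_controls_nonpos hu hw

theorem penalty_row_le {ε h : ℝ} (h3 : P.H3) (hε : 0 ≤ ε) (hh : h ∈ D.H) {n : ℕ} (hn : n ≤ D.N h)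
    {u : ℕ → ℕ → ℝ} {Cf B : ℝ} (hf : ∀ y ∈ P.dom, ∀ w, |P.f y w| ≤ Cf)
    (hB : ∀ i ≤ D.M h, u (n - 1) i ≤ B) (hu : ∀ i ≤ D.M h, 0 ≤ D.penaltySup ε h n i u) :
    ∀ i ≤ D.M h, u n i ≤ B + D.dt h * Cf := by
  obtain ⟨i, hi, hmax⟩ := exists_max_row (D := D) h (u n)
  refine fun j hj => (hmax j hj).trans ?_
  have hdt := D.dt_pos hh
  obtain ⟨w, -, hw⟩ := penaltySup_sub hh (hu i hi)
  have hg : 0 ≤ D.gam h u n i w := by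
    rcases hw with hw | hw
    · exact hw
    · by_contra! h0
      have h1 := discreteIntervention_lt h3 hh hn hmax i
      have h2 := mul_nonpos_of_nonneg_of_nonpos hε h0.le
      linarith
  have h5 := hg.trans (gam_max_le hh hmax w)
  have h6 := (abs_le.1 (hf _ (D.pt_mem_dom hh hn i) w)).2
  have h7 : 0 ≤ (u (n - 1) i - u n i) / D.dt h + Cf := by linarith
  have h8 := mul_nonneg hdt.le h7
  rw [mul_add, mul_div_cancel₀ _ hdt.ne'] at h8
  linarith [hB i hi]

theorem le_penalty_row {ε h : ℝ} (hh : h ∈ D.H) {n : ℕ} (hn : n ≤ D.N h)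
    {u : ℕ → ℕ → ℝ} {Cf B : ℝ} (hf : ∀ y ∈ P.dom, ∀ w, |P.f y w| ≤ Cf)
    (hB : ∀ i ≤ D.M h, B ≤ u (n - 1) i) (hu : ∀ i ≤ D.M h, D.penaltySup ε h n i u ≤ 0) :
    ∀ i ≤ D.M h, B - D.dt h * Cf ≤ u n i := by
  obtain ⟨i, hi, hmin⟩ := exists_min_row (D := D) h (u n)
  refine fun j hj => le_trans ?_ (hmin j hj)
  have hdt := D.dt_pos hh
  obtain ⟨w, hw⟩ := D.Wh_nonempty h hh
  have h5 := (le_gam_min hh hmin w).trans (penaltySup_super (hu i hi) hw).1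
  have h6 := (abs_le.1 (hf _ (D.pt_mem_dom hh hn i) w)).1
  have h7 : 0 ≤ Cf - (u (n - 1) i - u n i) / D.dt h := by linarith
  have h8 := mul_nonneg hdt.le h7
  rw [mul_sub, mul_div_cancel₀ _ hdt.ne'] at h8
  linarith [hB i hi]

variable {v : ℝ → ℕ → ℕ → ℝ}

theorem SolvesPenalty.penaltySup_eq {ε h : ℝ} {u : ℕ → ℕ → ℝ} (hu : D.SolvesPenalty ε h u) {n i : ℕ}
    (hn : 1 ≤ n) (hn' : n ≤ D.N h) (hi : i ≤ D.M h) : D.penaltySup ε h n i u = 0 := by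
  have h1 := hu n hn' i hi
  rwa [penaltyS, if_neg (by omega), neg_eq_zero] at h1

/-- The penalty contribution `ε γ` is harmless in both consistency inequalities because touching
bounds `γ` on the relevant side by its value at the test function, which converges. -/
theorem isConsistent_penalty [MetricSpace W] [CompactSpace W] [Nonempty W]
    (h1 : P.H1) (h3 : P.H3) (h4 : D.H4) {ε : ℝ → ℝ} (hε : ∀ h ∈ D.H, 0 ≤ ε h)
    (hε0 : Tendsto ε (𝓝[D.H] 0) (𝓝 0)) (hv : ∀ h ∈ D.H, D.SolvesPenalty (ε h) h (v h)) :
    D.IsConsistent v := by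
  obtain ⟨Cg, hCg⟩ := h1.bounded_g
  obtain ⟨Cf, hCf⟩ := h1.bounded_f
  have hterm : ∀ h ∈ D.H, ∀ i ≤ D.M h, v h 0 i = P.g (D.node h i) := fun h hh i hi => by
    have := hv h hh 0 (Nat.zero_le _) i hi
    rw [penaltyS, if_pos rfl] at this
    linarith
  have hCf0 : 0 ≤ Cf := (abs_nonneg _).trans
    (hCf (0, 0) ⟨⟨le_rfl, P.T_pos.le⟩, mem_univ _⟩ (Classical.arbitrary W))
  have hb : D.UniformBound v (Cg + P.T * Cf) := uniformBound_of_step hCf0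
    (fun h hh i hi => by rw [hterm h hh i hi]; exact hCg _)
    (fun h hh n hn hn' B hB => penalty_row_le h3 (hε h hh) hh hn' hCf hB
      fun i hi => ((hv h hh).penaltySup_eq hn hn' hi).ge)
    (fun h hh n hn hn' B hB => le_penalty_row hh hn' hCf hB
      fun i hi => ((hv h hh).penaltySup_eq hn hn' hi).le)
  refine ⟨⟨_, hb⟩, hterm, ?_, ?_⟩
  · intro κ G h n i y ψ r hy hψ ht hn
    have A := ht.approx
    have hex : ∀ k, ∃ w, h k ∈ D.H → 1 ≤ n k → n k ≤ D.N (h k) → i k ≤ D.M (h k) →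
        (0 ≤ D.gam (h k) (v (h k)) (n k) (i k) w ∨
        0 ≤ D.discreteIntervention (h k) (n k) (v (h k) (n k)) (i k) - v (h k) (n k) (i k)
          + ε (h k) * D.gam (h k) (v (h k)) (n k) (i k) w) := by
      intro k
      by_cases hk : h k ∈ D.H ∧ 1 ≤ n k ∧ n k ≤ D.N (h k) ∧ i k ≤ D.M (h k)
      · obtain ⟨w, -, hw⟩ := penaltySup_sub hk.1
          ((hv _ hk.1).penaltySup_eq hk.2.1 hk.2.2.1 hk.2.2.2).ge
        exact ⟨w, fun _ _ _ _ => hw⟩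
      · exact ⟨Classical.arbitrary W, fun a b c d => absurd ⟨a, b, c, d⟩ hk⟩
    choose w hw using hex
    obtain ⟨w₀, -, hw₀⟩ := exists_tendsto_of_isCompact isCompact_univ G (f := w)
      (.of_forall fun _ => mem_univ _)
    have hlim := tendsto_gam h1 A hy hn hψ hw₀
    have hle := ht.eventually_gam_le hn
    have hor : ∀ᶠ k in (G : Filter κ), 0 ≤ D.gam (h k) (v (h k)) (n k) (i k) (w k) ∨
        0 ≤ D.discreteIntervention (h k) (n k) (v (h k) (n k)) (i k) - v (h k) (n k) (i k)
          + ε (h k) * D.gam (h k) (v (h k)) (n k) (i k) (w k) := by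
      filter_upwards [A.eventually_mem, hn, A.n_le, A.i_le] with k a b c d using hw k a b c d
    rcases Ultrafilter.eventually_or.1 hor with hc | hc
    · refine .inr ⟨w₀, ge_of_tendsto hlim ?_⟩
      filter_upwards [hc, hle] with k a b using a.trans (b _)
    · have hr : Tendsto (fun k => v (h k) (n k) (i k) - ε (h k) *
          D.gam (h k) (fun n i => ψ (D.pt (h k) n i)) (n k) (i k) (w k)) G (𝓝 r) := by
        simpa using ht.tendsto_val.sub ((hε0.comp A.tendsto_mesh).mul hlim)
      refine .inl (le_intervention_of_tendsto h1 h3 h4 hb A A hy hr ?_)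
      filter_upwards [hc, hle, A.eventually_mem] with k a b c
      have := mul_le_mul_of_nonneg_left (b (w k)) (hε _ c)
      linarith
  · intro κ G h n i y ψ r hy hψ ht hn
    have A := ht.approx
    have hval : Tendsto (fun k => v (h k) (n k) (i k)) G (𝓝 r) := by
      simpa using ht.tendsto_val.neg
    have hle := ht.eventually_le_gam hn
    have hall : ∀ᶠ k in (G : Filter κ), ∀ w ∈ D.Wh (h k), D.gam (h k) (v (h k)) (n k) (i k) w ≤ 0 ∧
        D.discreteIntervention (h k) (n k) (v (h k) (n k)) (i k) - v (h k) (n k) (i k)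
          + ε (h k) * D.gam (h k) (v (h k)) (n k) (i k) w ≤ 0 := by
      filter_upwards [A.eventually_mem, hn, A.n_le, A.i_le] with k a b c d w hw
      exact penaltySup_super ((hv _ a).penaltySup_eq b c d).le hw
    refine ⟨?_, fun w₀ => ?_⟩
    · obtain ⟨w, hw, hw₀⟩ := exists_control_tendsto h4 A.tendsto_mesh (Classical.arbitrary W)
      have hr : Tendsto (fun k => v (h k) (n k) (i k) - ε (h k) *
          D.gam (h k) (fun n i => ψ (D.pt (h k) n i)) (n k) (i k) (w k)) G (𝓝 r) := by
        simpa using hval.sub ((hε0.comp A.tendsto_mesh).mul (tendsto_gam h1 A hy hn hψ hw₀))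
      refine intervention_le_of_tendsto h1 h4 hb A A hy hr ?_
      filter_upwards [hall, hle, A.eventually_mem, hw] with k a b c d
      have := mul_le_mul_of_nonneg_left (b (w k)) (hε _ c)
      linarith [(a _ d).2]
    · obtain ⟨w, hw, hw₀⟩ := exists_control_tendsto h4 A.tendsto_mesh w₀
      refine le_of_tendsto (tendsto_gam h1 A hy hn hψ hw₀) ?_
      filter_upwards [hall, hle, hw] with k a b c using (b _).trans (a _ c).1

/-! ### The explicit-impulse scheme -/

/-- The semi-Lagrangian counterpart of `gam` in the explicit-impulse scheme. -/
noncomputable def lagr (D : Discretization P) (b₀ : ℝ × ℝ → ℝ) (h : ℝ) (u : ℕ → ℕ → ℝ) (n i : ℕ)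
    (w : W) : ℝ :=
  (D.interp h (u (n - 1)) (D.node h i + P.a (D.pt h n i) w * D.dt h) - u n i) / D.dt h
    + 1 / 2 * b₀ (D.pt h n i) ^ 2 * D.D2 h (u n) i + P.f (D.pt h n i) w

/-- The impulse term of the explicit-impulse scheme. -/
noncomputable def explicitImpulse (D : Discretization P) (b₀ : ℝ × ℝ → ℝ) (h : ℝ) (u : ℕ → ℕ → ℝ)
    (n i : ℕ) : ℝ :=
  D.discreteIntervention h n (u (n - 1)) i - u n i
    + 1 / 2 * b₀ (D.pt h n i) ^ 2 * D.D2 h (u n) i * D.dt h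

section Explicit

variable {b₀ : ℝ × ℝ → ℝ} {h : ℝ} {u : ℕ → ℕ → ℝ} {n i : ℕ}

theorem SolvesExplicit.supOn_eq (hu : D.SolvesExplicit b₀ h u)
    (hn : 1 ≤ n) (hn' : n ≤ D.N h) (hi : i ≤ D.M h) :
    supOn (D.controls h) (fun c => (1 - c.1) * D.lagr b₀ h u n i c.2
      + c.1 * D.explicitImpulse b₀ h u n i) = 0 := by
  have h1 := hu n hn' i hi
  rwa [explicitS, if_neg (by omega), neg_eq_zero] at h1

theorem SolvesExplicit.sub (hu : D.SolvesExplicit b₀ h u) (hh : h ∈ D.H)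
    (hn : 1 ≤ n) (hn' : n ≤ D.N h) (hi : i ≤ D.M h) :
    ∃ w ∈ D.Wh h, 0 ≤ D.lagr b₀ h u n i w ∨ 0 ≤ D.explicitImpulse b₀ h u n i := by
  obtain ⟨w, hw, h1⟩ := exists_of_nonneg_supOn_controls hh (hu.supOn_eq hn hn' hi).ge
  exact ⟨w, hw, by simpa using h1⟩

theorem SolvesExplicit.super (hu : D.SolvesExplicit b₀ h u)
    (hn : 1 ≤ n) (hn' : n ≤ D.N h) (hi : i ≤ D.M h) {w : W} (hw : w ∈ D.Wh h) :
    D.lagr b₀ h u n i w ≤ 0 ∧ D.explicitImpulse b₀ h u n i ≤ 0 := by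
  simpa using forall_of_supOn_controls_nonpos (hu.supOn_eq hn hn' hi).le hw

theorem explicit_row_le (h3 : P.H3) (hu : D.SolvesExplicit b₀ h u) (hh : h ∈ D.H) (hn : 1 ≤ n)
    (hn' : n ≤ D.N h) {Cf B : ℝ} (hCf : 0 ≤ Cf) (hf : ∀ y ∈ P.dom, ∀ w, |P.f y w| ≤ Cf)
    (hB : ∀ i ≤ D.M h, u (n - 1) i ≤ B) : ∀ i ≤ D.M h, u n i ≤ B + D.dt h * Cf := by
  obtain ⟨i, hi, hmax⟩ := exists_max_row (D := D) h (u n)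
  refine fun j hj => (hmax j hj).trans ?_
  have hdt := D.dt_pos hh
  have h2 := D2_le hh (U := u n) (X := fun _ => 0) (i := i)
    (fun _ h => by simpa using hmax _ h) (fun _ _ => by simpa using hmax _ (by omega))
  rw [D2_const] at h2
  have h4 : 1 / 2 * b₀ (D.pt h n i) ^ 2 * D.D2 h (u n) i ≤ 0 :=
    mul_nonpos_of_nonneg_of_nonpos (by positivity) h2
  obtain ⟨w, -, hw | hw⟩ := hu.sub hh hn hn' hi
  · rw [lagr] at hw
    have h6 := (abs_le.1 (hf _ (D.pt_mem_dom hh hn' i) w)).2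
    have h5 := interp_le hh hB (D.node h i + P.a (D.pt h n i) w * D.dt h)
    set q := D.interp h (u (n - 1)) (D.node h i + P.a (D.pt h n i) w * D.dt h)
    have h7 : 0 ≤ (q - u n i) / D.dt h + Cf := by linarith
    have h8 := mul_nonneg hdt.le h7
    rw [mul_add, mul_div_cancel₀ _ hdt.ne'] at h8
    linarith
  · rw [explicitImpulse] at hw
    have h5 := discreteIntervention_lt h3 hh hn' hB i
    have h6 := mul_nonpos_of_nonpos_of_nonneg h4 hdt.le
    have h7 := mul_nonneg hdt.le hCf
    linarith

theorem le_explicit_row (hu : D.SolvesExplicit b₀ h u) (hh : h ∈ D.H) (hn : 1 ≤ n)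
    (hn' : n ≤ D.N h) {Cf B : ℝ} (hf : ∀ y ∈ P.dom, ∀ w, |P.f y w| ≤ Cf)
    (hB : ∀ i ≤ D.M h, B ≤ u (n - 1) i) : ∀ i ≤ D.M h, B - D.dt h * Cf ≤ u n i := by
  obtain ⟨i, hi, hmin⟩ := exists_min_row (D := D) h (u n)
  refine fun j hj => le_trans ?_ (hmin j hj)
  have hdt := D.dt_pos hh
  obtain ⟨w, hw⟩ := D.Wh_nonempty h hh
  have h2 := D2_le hh (X := u n) (U := fun _ => 0) (i := i)
    (fun _ h => by simpa using hmin _ h) (fun _ _ => by simpa using hmin _ (by omega))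
  rw [D2_const] at h2
  have h4 : 0 ≤ 1 / 2 * b₀ (D.pt h n i) ^ 2 * D.D2 h (u n) i := by positivity
  have h5 := (hu.super hn hn' hi hw).1
  rw [lagr] at h5
  have h6 := (abs_le.1 (hf _ (D.pt_mem_dom hh hn' i) w)).1
  have h9 := le_interp hh hB (D.node h i + P.a (D.pt h n i) w * D.dt h)
  set q := D.interp h (u (n - 1)) (D.node h i + P.a (D.pt h n i) w * D.dt h)
  have h7 : 0 ≤ Cf - (q - u n i) / D.dt h := by linarith
  have h8 := mul_nonneg hdt.le h7
  rw [mul_sub, mul_div_cancel₀ _ hdt.ne'] at h8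
  linarith

end Explicit

/-- The diffusion in the impulse term carries a factor `Δτ`, so it disappears in the limit, and the
intervention of the previous time level has the same limit as that of the current one. -/
theorem isConsistent_explicit [MetricSpace W] [CompactSpace W] [Nonempty W]
    (h1 : P.H1) (h3 : P.H3) (h4 : D.H4) {b₀ : ℝ × ℝ → ℝ} (hb₀ : ∀ y ∈ P.dom, ∀ w, P.b y w = b₀ y)
    (hv : ∀ h ∈ D.H, D.SolvesExplicit b₀ h (v h)) : D.IsConsistent v := by
  obtain ⟨Cg, hCg⟩ := h1.bounded_g
  obtain ⟨Cf, hCf⟩ := h1.bounded_f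
  have hterm : ∀ h ∈ D.H, ∀ i ≤ D.M h, v h 0 i = P.g (D.node h i) := fun h hh i hi => by
    have := hv h hh 0 (Nat.zero_le _) i hi
    rw [explicitS, if_pos rfl] at this
    linarith
  have hCf0 : 0 ≤ Cf := (abs_nonneg _).trans
    (hCf (0, 0) ⟨⟨le_rfl, P.T_pos.le⟩, mem_univ _⟩ (Classical.arbitrary W))
  have hb : D.UniformBound v (Cg + P.T * Cf) := uniformBound_of_step hCf0
    (fun h hh i hi => by rw [hterm h hh i hi]; exact hCg _)
    (fun h hh n hn hn' B hB => explicit_row_le h3 (hv h hh) hh hn hn' hCf0 hCf hB)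
    (fun h hh n hn hn' B hB => le_explicit_row (hv h hh) hh hn hn' hCf hB)
  have hdiff : ∀ {κ : Type} {G : Filter κ} {h : κ → ℝ} {n i : κ → ℕ} {y : ℝ × ℝ} {ψ : ℝ × ℝ → ℝ},
      y ∈ P.dom → D.Approx G h n i y → ContDiff ℝ 2 ψ → ∀ w : W,
      Tendsto (fun k => 1 / 2 * b₀ (D.pt (h k) (n k) (i k)) ^ 2 *
        D.D2 (h k) (fun i => ψ (D.pt (h k) (n k) i)) (i k)) G
        (𝓝 (1 / 2 * P.b y w ^ 2 * iteratedDeriv 2 (fun x => ψ (y.1, x)) y.2)) := by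
    intro κ G h n i y ψ hy A hψ w
    have hbb := tendsto_coefficient A hy h1.continuous_b (tendsto_const_nhds (x := w))
    refine (((hbb.pow 2).const_mul (1 / 2)).mul (tendsto_D2 A hψ)).congr' ?_
    filter_upwards [A.eventually_mem, A.n_le] with k a b
    rw [hb₀ _ (D.pt_mem_dom a b _)]
  refine ⟨⟨_, hb⟩, hterm, ?_, ?_⟩
  · intro κ G h n i y ψ r hy hψ ht hn
    have A := ht.approx
    have hex : ∀ k, ∃ w, h k ∈ D.H → 1 ≤ n k → n k ≤ D.N (h k) → i k ≤ D.M (h k) →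
        (0 ≤ D.lagr b₀ (h k) (v (h k)) (n k) (i k) w ∨
          0 ≤ D.explicitImpulse b₀ (h k) (v (h k)) (n k) (i k)) := by
      intro k
      by_cases hk : h k ∈ D.H ∧ 1 ≤ n k ∧ n k ≤ D.N (h k) ∧ i k ≤ D.M (h k)
      · obtain ⟨w, -, hw⟩ := (hv _ hk.1).sub hk.1 hk.2.1 hk.2.2.1 hk.2.2.2
        exact ⟨w, fun _ _ _ _ => hw⟩
      · exact ⟨Classical.arbitrary W, fun a b c d => absurd ⟨a, b, c, d⟩ hk⟩
    choose w hw using hex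
    obtain ⟨w₀, -, hw₀⟩ := exists_tendsto_of_isCompact isCompact_univ G (f := w)
      (.of_forall fun _ => mem_univ _)
    have hD2 := hdiff hy A hψ w₀
    have hor : ∀ᶠ k in (G : Filter κ), 0 ≤ D.lagr b₀ (h k) (v (h k)) (n k) (i k) (w k) ∨
        0 ≤ D.explicitImpulse b₀ (h k) (v (h k)) (n k) (i k) := by
      filter_upwards [A.eventually_mem, hn, A.n_le, A.i_le] with k a b c d using hw k a b c d
    rcases Ultrafilter.eventually_or.1 hor with hc | hc
    · obtain ⟨q, hq, hle⟩ := ht.exists_semiLagrangian_le hn hψ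
        (tendsto_coefficient A hy h1.continuous_a hw₀)
      refine .inr ⟨w₀, ?_⟩
      have hlim := (hq.add hD2).add (tendsto_coefficient A hy h1.continuous_f hw₀)
      have := ge_of_tendsto (b := 0) hlim (by
        filter_upwards [hc, hle, ht.eventually_D2_le] with k a b c
        rw [lagr] at a
        have := mul_le_mul_of_nonneg_left c
          (show 0 ≤ 1 / 2 * b₀ (D.pt (h k) (n k) (i k)) ^ 2 by positivity)
        linarith)
      rw [Problem.ham]
      linarith
    · have hr : Tendsto (fun k => v (h k) (n k) (i k) - 1 / 2 * b₀ (D.pt (h k) (n k) (i k)) ^ 2 *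
          D.D2 (h k) (fun i => ψ (D.pt (h k) (n k) i)) (i k) * D.dt (h k)) G (𝓝 r) := by
        simpa only [mul_zero, sub_zero] using ht.tendsto_val.sub (hD2.mul A.tendsto_dt)
      refine .inl (le_intervention_of_tendsto h1 h3 h4 hb A (A.pred_time hn) hy hr ?_)
      filter_upwards [hc, ht.eventually_D2_le, A.eventually_mem] with k a b c
      rw [explicitImpulse] at a
      have h5 := D.dt_pos c
      have : 1 / 2 * b₀ (D.pt (h k) (n k) (i k)) ^ 2 * D.D2 (h k) (v (h k) (n k)) (i k) * D.dt (h k)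
          ≤ 1 / 2 * b₀ (D.pt (h k) (n k) (i k)) ^ 2 *
            D.D2 (h k) (fun i => ψ (D.pt (h k) (n k) i)) (i k) * D.dt (h k) := by gcongr
      linarith
  · intro κ G h n i y ψ r hy hψ ht hn
    have A := ht.approx
    have hval : Tendsto (fun k => v (h k) (n k) (i k)) G (𝓝 r) := by
      simpa using ht.tendsto_val.neg
    have hall : ∀ᶠ k in (G : Filter κ), ∀ w ∈ D.Wh (h k),
        D.lagr b₀ (h k) (v (h k)) (n k) (i k) w ≤ 0 ∧
          D.explicitImpulse b₀ (h k) (v (h k)) (n k) (i k) ≤ 0 := by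
      filter_upwards [A.eventually_mem, hn, A.n_le, A.i_le] with k a b c d w hw
      exact (hv _ a).super b c d hw
    refine ⟨?_, fun w₀ => ?_⟩
    · have hD2 := hdiff hy A hψ (Classical.arbitrary W)
      have hr : Tendsto (fun k => v (h k) (n k) (i k) - 1 / 2 * b₀ (D.pt (h k) (n k) (i k)) ^ 2 *
          D.D2 (h k) (fun i => ψ (D.pt (h k) (n k) i)) (i k) * D.dt (h k)) G (𝓝 r) := by
        simpa only [mul_zero, sub_zero] using hval.sub (hD2.mul A.tendsto_dt)
      refine intervention_le_of_tendsto h1 h4 hb A (A.pred_time hn) hy hr ?_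
      filter_upwards [hall, ht.eventually_le_D2, A.eventually_mem] with k a b c
      obtain ⟨w, hw⟩ := D.Wh_nonempty _ c
      have a := (a w hw).2
      rw [explicitImpulse] at a
      have h5 := D.dt_pos c
      have : 1 / 2 * b₀ (D.pt (h k) (n k) (i k)) ^ 2 *
            D.D2 (h k) (fun i => ψ (D.pt (h k) (n k) i)) (i k) * D.dt (h k)
          ≤ 1 / 2 * b₀ (D.pt (h k) (n k) (i k)) ^ 2 * D.D2 (h k) (v (h k) (n k)) (i k)
            * D.dt (h k) := by gcongr
      linarith
    · obtain ⟨w, hw, hw₀⟩ := exists_control_tendsto h4 A.tendsto_mesh w₀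
      obtain ⟨q, hq, hle⟩ := ht.exists_le_semiLagrangian hn hψ
        (tendsto_coefficient A hy h1.continuous_a hw₀)
      have hlim := (hq.add (hdiff hy A hψ w₀)).add (tendsto_coefficient A hy h1.continuous_f hw₀)
      have := le_of_tendsto (b := 0) hlim (by
        filter_upwards [hall, hle, ht.eventually_le_D2, hw] with k a b c d
        have a := (a _ d).1
        rw [lagr] at a
        have := mul_le_mul_of_nonneg_left c
          (show 0 ≤ 1 / 2 * b₀ (D.pt (h k) (n k) (i k)) ^ 2 by positivity)
        linarith)
      rw [Problem.ham]
      linarith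

end Discretization

end HJBQVI

namespace HJBQVI

/-! ### Existence of solutions of the direct control scheme -/

/-- Perron's method for degenerate elliptic systems: if `Φ V i` is continuous and is nondecreasing in
the components `V j`, `j ≠ i`, then the pointwise supremum of all `V` with `Φ V ≥ 0` solves
`Φ V = 0`, provided that such `V` exist and are bounded above. -/
theorem exists_eq_zero_of_monotone {ι : Type*} {Φ : (ι → ℝ) → ι → ℝ}
    (hmono : ∀ V V' : ι → ℝ, ∀ i, V ≤ V' → V i = V' i → Φ V i ≤ Φ V' i)
    (hcont : ∀ i, Continuous fun V => Φ V i) {V₀ : ι → ℝ} (hV₀ : ∀ i, 0 ≤ Φ V₀ i) {B : ℝ}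
    (hB : ∀ V, (∀ i, 0 ≤ Φ V i) → ∀ i, V i ≤ B) : ∃ V, ∀ i, Φ V i = 0 := by
  classical
  let S : Set (ι → ℝ) := {V | ∀ i, 0 ≤ Φ V i}
  let Vs : ι → ℝ := fun i => sSup ((fun V : ι → ℝ => V i) '' S)
  have hbdd : ∀ i, BddAbove ((fun V : ι → ℝ => V i) '' S) := fun i =>
    ⟨B, by rintro _ ⟨V, hV, rfl⟩; exact hB V hV i⟩
  have hle : ∀ V ∈ S, V ≤ Vs := fun V hV i => le_csSup (hbdd i) ⟨V, hV, rfl⟩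
  have hupd : ∀ i, Continuous fun s : ℝ => Φ (Function.update Vs i s) i := fun i =>
    (hcont i).comp (continuous_const.update i continuous_id)
  have hsub : Vs ∈ S := by
    intro i
    have h1 : Vs i ∈ closure ((fun V : ι → ℝ => V i) '' S) :=
      csSup_mem_closure ⟨_, V₀, hV₀, rfl⟩ (hbdd i)
    have hcl : IsClosed {s : ℝ | 0 ≤ Φ (Function.update Vs i s) i} :=
      isClosed_le continuous_const (hupd i)
    have h2 : (fun V : ι → ℝ => V i) '' S ⊆ {s : ℝ | 0 ≤ Φ (Function.update Vs i s) i} := by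
      rintro _ ⟨V, hV, rfl⟩
      refine (hV i).trans (hmono _ _ i (fun j => ?_) (by simp))
      rcases eq_or_ne j i with rfl | hj
      · simp
      · simpa [hj] using hle V hV j
    have h3 := closure_minimal h2 hcl h1
    simpa using h3
  refine ⟨Vs, fun i => le_antisymm ?_ (hsub i)⟩
  by_contra! hpos
  -- otherwise the `i`-th component could be increased a little
  have h1 : ∀ᶠ s in 𝓝 (Vs i), 0 < Φ (Function.update Vs i s) i :=
    (hupd i).continuousAt.eventually (lt_mem_nhds (by simpa using hpos))
  obtain ⟨s, hs1, hs2⟩ := ((h1.filter_mono nhdsWithin_le_nhds).and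
    (self_mem_nhdsWithin : Ioi (Vs i) ∈ 𝓝[>] (Vs i))).exists
  have h2 : Function.update Vs i s ∈ S := by
    intro j
    rcases eq_or_ne j i with rfl | hj
    · exact hs1.le
    · refine (hsub j).trans (hmono _ _ j (fun k => ?_) (by simp [hj]))
      rcases eq_or_ne k i with rfl | hk
      · simpa using (mem_Ioi.1 hs2).le
      · simp [hk]
  have h3 := hle _ h2 i
  rw [Function.update_self] at h3
  exact (mem_Ioi.1 hs2).not_ge h3

theorem continuous_supOn {X α : Type*} [TopologicalSpace X] {s : Set α} (hs : s.Finite)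
    (hne : s.Nonempty) {f : X → α → ℝ} (hf : ∀ a ∈ s, Continuous fun x => f x a) :
    Continuous fun x => supOn s (f x) := by
  have hne' : hs.toFinset.Nonempty := by simpa using hne
  have h1 : (fun x => supOn s (f x)) = fun x => hs.toFinset.sup' hne' (f x) := by
    funext x
    rw [Finset.sup'_eq_csSup_image, supOn, hs.coe_toFinset]
  rw [h1]
  exact Continuous.finset_sup'_apply hne' fun a ha => hf a (by simpa using ha)

namespace Discretization

variable {W Y : Type*} [MetricSpace Y] {P : Problem W Y} {D : Discretization P}

theorem continuous_interp {h : ℝ} (hh : h ∈ D.H) (x : ℝ) :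
    Continuous fun U : ℕ → ℝ => D.interp h U x := by
  obtain ⟨j, j', α, -, -, -, -, he, -⟩ := D.exists_interp_eq hh x
  simp only [he]
  fun_prop

theorem continuous_D2 (h : ℝ) (i : ℕ) : Continuous fun U : ℕ → ℝ => D.D2 h U i := by
  unfold D2
  split_ifs <;> fun_prop

theorem continuous_upwind (h α : ℝ) (i : ℕ) : Continuous fun U : ℕ → ℝ => D.upwind h α U i := by
  unfold upwind Dplus Dminus
  split_ifs <;> fun_prop

theorem continuous_discreteIntervention {h : ℝ} (hh : h ∈ D.H) {n : ℕ} (hn : n ≤ D.N h) (i : ℕ) :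
    Continuous fun U : ℕ → ℝ => D.discreteIntervention h n U i :=
  continuous_supOn (D.Zh_finite h hh _ (D.pt_mem_dom hh hn i)) (D.Zh _ _).nonempty
    fun _ _ => (continuous_interp hh _).add continuous_const

theorem discreteIntervention_mono {h : ℝ} (hh : h ∈ D.H) {n : ℕ} (hn : n ≤ D.N h) {U U' : ℕ → ℝ}
    (hU : U ≤ U') (i : ℕ) : D.discreteIntervention h n U i ≤ D.discreteIntervention h n U' i := by
  refine supOn_le (D.Zh _ _).nonempty fun z hz => ?_
  refine le_trans ?_ (le_supOn (D.Zh_finite h hh _ (D.pt_mem_dom hh hn i)) _ hz)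
  exact add_le_add_left (D.interp_mono hh (fun i _ => hU i) _) _

theorem penaltySup_congr {ε h : ℝ} {n i : ℕ} {u u' : ℕ → ℕ → ℝ} (h1 : u (n - 1) = u' (n - 1))
    (h2 : u n = u' n) : D.penaltySup ε h n i u = D.penaltySup ε h n i u' := by
  simp only [penaltySup, gam, h1, h2]

/-- One implicit time step of the direct control scheme can be solved from any previous row `u`. -/
theorem exists_direct_step [TopologicalSpace W] (h1 : P.H1) (h3 : P.H3) {h : ℝ} (hh : h ∈ D.H) {n : ℕ} (hn : 1 ≤ n)
    (hn' : n ≤ D.N h) (u : ℕ → ℝ) : ∃ V : ℕ → ℝ, ∀ i ≤ D.M h,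
      D.penaltySup 0 h n i (Function.update (fun _ => u) n V) = 0 := by
  have hne : n - 1 ≠ n := by omega
  have hdt := D.dt_pos hh
  obtain ⟨Cf, hCf⟩ := h1.bounded_f
  obtain ⟨w, hw⟩ := D.Wh_nonempty h hh
  have hCf0 : 0 ≤ Cf := (abs_nonneg _).trans
    (hCf (0, 0) ⟨⟨le_rfl, P.T_pos.le⟩, mem_univ _⟩ w)
  obtain ⟨m, -, hm⟩ := exists_max_row (D := D) h fun i => |u i|
  have hL : 0 ≤ |u m| + D.dt h * Cf := by positivity
  let R : (ℕ → ℝ) → ℕ → ℕ → ℝ := fun V => Function.update (fun _ => u) n V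
  have hRn : ∀ V, R V n = V := fun V => by simp [R]
  have hRp : ∀ V, R V (n - 1) = u := fun V => by simp [R, hne]
  -- beyond the grid the unknowns are decoupled and set to zero
  suffices H : ∃ V : ℕ → ℝ, ∀ i,
      (if i ≤ D.M h then D.penaltySup 0 h n i (R V) else -V i) = 0 by
    obtain ⟨V, hV⟩ := H
    exact ⟨V, fun i hi => by simpa [hi] using hV i⟩
  refine exists_eq_zero_of_monotone
    (Φ := fun V i => if i ≤ D.M h then D.penaltySup 0 h n i (R V) else -V i)
    (V₀ := fun _ => -(|u m| + D.dt h * Cf)) ?_ ?_ ?_ (B := |u m| + D.dt h * Cf) ?_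
  · intro V V' i hle heq
    split_ifs with hi
    · refine supOn_le (controls_nonempty hh) fun c hc => ?_
      refine le_trans ?_ (le_supOn (controls_finite h) _ hc)
      have hg : D.gam h (R V) n i c.2 ≤ D.gam h (R V') n i c.2 := by
        have := fun j => hle j
        refine gam_le hh c.2 ?_ ?_ ?_ <;> simp only [hRn, hRp, heq, sub_self, tsub_le_iff_right,
          zero_add, le_refl, implies_true, this]
      have hI := discreteIntervention_mono hh hn' hle i
      have hc1 : 0 ≤ c.1 ∧ 0 ≤ 1 - c.1 := by
        rcases hc.1 with hd | hd
        · simp [hd]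
        · rw [mem_singleton_iff] at hd; simp [hd]
      obtain ⟨hc0, hc1⟩ := hc1
      simp only [hRn, zero_mul, add_zero, heq]
      gcongr
    · rw [heq]
  · intro i
    by_cases hi : i ≤ D.M h
    · simp only [if_pos hi]
      refine continuous_supOn (controls_finite h) (controls_nonempty hh) fun c _ => ?_
      have e1 := continuous_D2 (D := D) h i
      have e2 := continuous_upwind (D := D) h (P.a (D.pt h n i) c.2) i
      have e3 := continuous_discreteIntervention hh hn' i
      simp only [gam, hRn, hRp]
      fun_prop
    · simp only [if_neg hi]
      fun_prop
  · intro i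
    split_ifs with hi
    · refine le_trans ?_ (le_supOn (controls_finite h) _ (a := ((0 : ℝ), w)) ⟨.inl rfl, hw⟩)
      simp only [sub_zero, one_mul, zero_mul, add_zero]
      refine le_trans ?_ (le_gam_min hh (fun j _ => by simp only [hRn, le_refl]) w)
      simp only [hRn, hRp]
      have h5 := (abs_le.1 (hCf _ (D.pt_mem_dom hh hn' i) w)).1
      have h6 := (abs_le.1 (hm i hi)).1
      have h7 : Cf ≤ (u i - -(|u m| + D.dt h * Cf)) / D.dt h := by
        rw [le_div_iff₀ hdt]; linarith
      linarith
    · simpa using hL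
  · intro V hV i
    by_cases hi : i ≤ D.M h
    · have h5 := penalty_row_le (u := R V) h3 le_rfl hh hn' hCf (B := |u m|)
        (fun j hj => by rw [hRp]; exact (le_abs_self _).trans (hm j hj))
        (fun j hj => by simpa [hj] using hV j) i hi
      rwa [hRn] at h5
    · have h5 := hV i
      simp only [if_neg hi] at h5
      linarith

theorem exists_solvesDirect [TopologicalSpace W] (h1 : P.H1) (h3 : P.H3) {h : ℝ} (hh : h ∈ D.H) :
    ∃ u, D.SolvesDirect h u := by
  have hex : ∀ (n : ℕ) (u : ℕ → ℝ), ∃ V : ℕ → ℝ, 1 ≤ n → n ≤ D.N h → ∀ i ≤ D.M h,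
      D.penaltySup 0 h n i (Function.update (fun _ => u) n V) = 0 := by
    intro n u
    by_cases hn : 1 ≤ n ∧ n ≤ D.N h
    · obtain ⟨V, hV⟩ := exists_direct_step h1 h3 hh hn.1 hn.2 u
      exact ⟨V, fun _ _ => hV⟩
    · exact ⟨0, fun a b => absurd ⟨a, b⟩ hn⟩
  choose step hstep using hex
  let u : ℕ → ℕ → ℝ := fun n =>
    Nat.rec (fun i => P.g (D.node h i)) (fun n U => step (n + 1) U) n
  refine ⟨u, fun n hn i hi => ?_⟩
  rw [← penaltyS_zero, penaltyS]
  rcases n with _ | n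
  · simp [u]
  · rw [if_neg (by omega), neg_eq_zero]
    have h2 := hstep (n + 1) (u n) (by omega) hn i hi
    rw [penaltySup_congr (u' := u) (by simp) (by simp [u])] at h2
    exact h2

theorem SolvesDirect.solvesPenalty {h : ℝ} {u : ℕ → ℕ → ℝ} (hu : D.SolvesDirect h u) :
    D.SolvesPenalty 0 h u := fun n hn i hi => by
  rw [penaltyS_zero]
  exact hu n hn i hi

theorem isConsistent_direct [MetricSpace W] [CompactSpace W] [Nonempty W] {v : ℝ → ℕ → ℕ → ℝ}
    (h1 : P.H1) (h3 : P.H3) (h4 : D.H4) (hv : ∀ h ∈ D.H, D.SolvesDirect h (v h)) :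
    D.IsConsistent v :=
  isConsistent_penalty h1 h3 h4 (ε := fun _ => 0) (fun _ _ => le_rfl) tendsto_const_nhds
    fun h hh => (hv h hh).solvesPenalty

end Discretization

end HJBQVI

theorem mainTheorem2 {W Y : Type*} [MetricSpace W] [CompactSpace W] [Nonempty W] [MetricSpace Y]
    (P : HJBQVI.Problem W Y) (D : HJBQVI.Discretization P)
    (h1 : P.H1) (h3 : P.H3) (h4 : D.H4) (hcomp : P.Comparison) :
    ∃ V : ℝ × ℝ → ℝ,
      (P.IsBdd V ∧ P.IsSolution V ∧
        ∀ V' : ℝ × ℝ → ℝ, P.IsBdd V' → P.IsSolution V' → Set.EqOn V' V P.dom) ∧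
      (∀ v : ℝ → ℕ → ℕ → ℝ, (∀ h ∈ D.H, D.SolvesDirect h (v h)) → D.ConvergesTo v V) ∧
      (∀ ε : ℝ → ℝ, (∀ h ∈ D.H, 0 < ε h) → Tendsto ε (𝓝[D.H] 0) (𝓝 0) →
        ∀ v : ℝ → ℕ → ℕ → ℝ, (∀ h ∈ D.H, D.SolvesPenalty (ε h) h (v h)) → D.ConvergesTo v V) ∧
      (∀ b₀ : ℝ × ℝ → ℝ, (∀ y ∈ P.dom, ∀ w, P.b y w = b₀ y) →
        ∀ v : ℝ → ℕ → ℕ → ℝ, (∀ h ∈ D.H, D.SolvesExplicit b₀ h (v h)) → D.ConvergesTo v V) := by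
  have hex : ∀ h, ∃ u, h ∈ D.H → D.SolvesDirect h u := fun h => by
    by_cases hh : h ∈ D.H
    · obtain ⟨u, hu⟩ := HJBQVI.Discretization.exists_solvesDirect h1 h3 hh
      exact ⟨u, fun _ => hu⟩
    · exact ⟨0, fun hh' => absurd hh' hh⟩
  choose v₀ hv₀ using hex
  obtain ⟨hV, hVs, -⟩ := (HJBQVI.Discretization.isConsistent_direct h1 h3 h4
    hv₀).convergesTo_upper h1 h3 hcomp
  have huniq : ∀ V', P.IsBdd V' → P.IsSolution V' → EqOn V' (D.upper v₀) P.dom :=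
    fun V' hb hs y hy => le_antisymm (hcomp _ _ hb hV hs.1 hVs.2 y hy)
      (hcomp _ _ hV hb hVs.1 hs.2 y hy)
  have hconv : ∀ v, D.IsConsistent v → D.ConvergesTo v (D.upper v₀) := fun v hv => by
    obtain ⟨hb, hs, hc⟩ := hv.convergesTo_upper h1 h3 hcomp
    exact hc.congr_right (huniq _ hb hs)
  exact ⟨D.upper v₀, ⟨hV, hVs, huniq⟩,
    fun v hv => hconv v (HJBQVI.Discretization.isConsistent_direct h1 h3 h4 hv),
    fun ε hε hε0 v hv => hconv v
      (HJBQVI.Discretization.isConsistent_penalty h1 h3 h4 (fun h hh => (hε h hh).le) hε0 hv),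
    fun b₀ hb₀ v hv => hconv v (HJBQVI.Discretization.isConsistent_explicit h1 h3 h4 hb₀ hv)⟩
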